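/- A *loop* is a closed, continuous, piecewise $C^1$ curve in $\mathbf R^3$. For two disjoint loops $C:t\in[0,t_0]\mapsto \mathbf m(t)$ and $L:s\in[0,s_0]\mapsto \mathbf l(s)$, let $$\mathbf A(C,L)=\frac1{4\pi}\int_0^{s_0}ds\int_0^{t_0}dt\,\frac{\bigl((\mathbf l(s)-\mathbf m(t))\times\frac{d\mathbf m}{dt}(t)\bigr)\cdot\frac{d\mathbf l}{ds}(s)}{\|\mathbf l(s)-\mathbf m(t)\|^3}$$ be the Gauss integral. By an *oriented surface* we mean a compact $C^2$ surface $S$ embedded in $\mathbf R^3$ (not necessarily connected), with a continuous unit normal field and with piecewise smooth boundary: near each point, a $C^2$ diffeomorphism between open sets of $\mathbf R^3$ takes $S$ to the plane $z=0$ or, for some $c\in\mathbf R$ and with the point going to the origin, to the sector $\{z=0,\ y\ge c|x|\}$. Its boundary carries the induced orientation: the normal of $S$ crossed with the tangent of the boundary points into $S$. Then: 1. $\mathbf A(C,L)=\mathbf A(L,C)$ for any two disjoint loops $C$ and $L$. 2. Let $C$, $L$, $L'$ be loops and let $S$ be an oriented surface with $\partial S=L\cup -L'$; that is, $L$ and $L'$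 are simple and disjoint, the boundary of $S$ is the union of their point sets, and the induced orientation is that of $L$ on $L$ and that of $-L'$ on $L'$, where $-L'$ denotes $L'$ with the orientation reversed. If $S$ does not intersect $C$, then $\mathbf A(C,L)=\mathbf A(C,L')$. -/

import Mathlib

open scoped Matrix

namespace GaussIntegral

/-- Euclidean three-space. -/
abbrev E3 : Type := EuclideanSpace ℝ (Fin 3)

/-- The cross product on Euclidean three-space. -/
noncomputable def cross (x y : E3) : E3 :=
  WithLp.toLp 2 (x.ofLp ⨯₃ y.ofLp)

/-- A loop in three-space: a closed, continuous, piecewise continuously differentiable curve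
`[0, period] → E3`. The values of `toFun` outside `[0, period]` are irrelevant. The curve need
neither be injective nor have a nonvanishing derivative. -/
structure Loop where
  toFun : ℝ → E3
  period : ℝ
  period_pos : 0 < period
  closed : toFun 0 = toFun period
  /-- There is a subdivision of `[0, period]` on each closed interval of which the curve is `C¹`
  (in particular the curve is continuous). -/
  piecewise_contDiffOn : ∃ (N : ℕ) (a : Fin (N + 1) → ℝ), StrictMono a ∧
    a 0 = 0 ∧ a (Fin.last N) = period ∧
    ∀ i : Fin N, ContDiffOn ℝ 1 toFun (Set.Icc (a i.castSucc) (a i.succ))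

namespace Loop

/-- The point set traced out by a loop. -/
def image (C : Loop) : Set E3 := C.toFun '' Set.Icc 0 C.period

/-- A loop is simple if it visits no point twice, apart from its coinciding end points. -/
def IsSimple (C : Loop) : Prop := Set.InjOn C.toFun (Set.Ico 0 C.period)

/-- The same curve with the orientation reversed. -/
def reverse (C : Loop) : Loop where
  toFun t := C.toFun (C.period - t)
  period := C.period
  period_pos := C.period_pos
  closed := by simpa using C.closed.symm
  piecewise_contDiffOn := by
    obtain ⟨N, a, hmono, h0, hN, hC⟩ := C.piecewise_contDiffOn
    refine ⟨N, fun i => C.period - a i.rev, ?_, ?_, ?_, ?_⟩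
    · intro i j hij
      have := hmono (Fin.rev_lt_rev.mpr hij)
      simp only
      linarith
    · simp [hN]
    · simp [h0]
    · intro i
      refine (hC i.rev).comp (contDiff_const.sub contDiff_id).contDiffOn ?_
      intro t ht
      simp only [Fin.rev_castSucc, Fin.rev_succ, Set.mem_Icc] at ht
      simp only [Set.mem_Icc]
      constructor <;> linarith [ht.1, ht.2]

end Loop

/-- The Gauss integral `A(C, L)`, with `C : t ↦ m(t)` and `L : s ↦ l(s)`:
`(1 / 4π) ∫ ds ∫ dt ((l(s) - m(t)) × m'(t)) · l'(s) / ‖l(s) - m(t)‖ ^ 3`.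
The derivatives exist except at finitely many parameters. -/
noncomputable def A (C L : Loop) : ℝ :=
  1 / (4 * Real.pi) *
    ∫ s in (0 : ℝ)..L.period, ∫ t in (0 : ℝ)..C.period,
      inner ℝ (cross (L.toFun s - C.toFun t) (deriv C.toFun t)) (deriv L.toFun s) /
        ‖L.toFun s - C.toFun t‖ ^ 3

/-- `Φ` is a diffeomorphism of class `C²` between open subsets of three-space. -/
def IsC2Diffeo (Φ : OpenPartialHomeomorph E3 E3) : Prop :=
  ContDiffOn ℝ 2 Φ Φ.source ∧ ContDiffOn ℝ 2 Φ.symm Φ.target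

/-- Near `p`, the set `S` is a surface without boundary: a `C²` diffeomorphism of neighbourhoods
in three-space straightens it to the coordinate plane `z = 0`. -/
def IsInteriorPoint (S : Set E3) (p : E3) : Prop :=
  ∃ Φ : OpenPartialHomeomorph E3 E3, IsC2Diffeo Φ ∧ p ∈ Φ.source ∧
    ∀ x ∈ Φ.source, (x ∈ S ↔ Φ x 2 = 0)

/-- Near `p`, the set `S` is a surface with `p` on its boundary: a `C²` diffeomorphism of
neighbourhoods in three-space takes `p` to the origin and straightens `S` to the part
`y ≥ c |x|` of the plane `z = 0`. For `c = 0` this is a half plane, so that the boundary is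
smooth at `p`; for `c > 0` it is a sector with a convex corner at the origin, for `c < 0` one
with a reentrant corner. -/
def IsBoundaryPoint (S : Set E3) (p : E3) : Prop :=
  ∃ (c : ℝ) (Φ : OpenPartialHomeomorph E3 E3), IsC2Diffeo Φ ∧ p ∈ Φ.source ∧ Φ p = 0 ∧
    ∀ x ∈ Φ.source, (x ∈ S ↔ Φ x 2 = 0 ∧ c * |Φ x 0| ≤ Φ x 1)

/-- A compact oriented surface of class `C²` embedded in three-space, with a (possibly empty)
piecewise smooth boundary, the orientation being given by a continuous unit normal field.
The surface need not be connected. -/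
structure OrientedSurface where
  carrier : Set E3
  isCompact_carrier : IsCompact carrier
  isSurface : ∀ p ∈ carrier, IsInteriorPoint carrier p ∨ IsBoundaryPoint carrier p
  /-- The unit normal in the positive direction; only its values on the surface matter. -/
  normal : E3 → E3
  continuousOn_normal : ContinuousOn normal carrier
  norm_normal : ∀ p ∈ carrier, ‖normal p‖ = 1
  normal_orthogonal : ∀ p ∈ carrier, ∀ v ∈ tangentConeAt ℝ carrier p, inner ℝ (normal p) v = 0

namespace OrientedSurface

/-- The boundary of a surface, as a point set. -/
def boundary (S : OrientedSurface) : Set E3 := {p ∈ S.carrier | IsBoundaryPoint S.carrier p}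

/-- The loop `L`, lying on the boundary of `S`, runs in the direction of the induced orientation:
looking along `L` with the positive normal pointing up, the surface is to the left. That is, the
vector `normal × L'` points into the surface, wherever `L` is differentiable (at a corner of the
boundary, or where `L'` vanishes, this says nothing). -/
def InducesOrientationOf (S : OrientedSurface) (L : Loop) : Prop :=
  ∀ t ∈ Set.Ioo 0 L.period, DifferentiableAt ℝ L.toFun t →
    cross (S.normal (L.toFun t)) (deriv L.toFun t) ∈ posTangentConeAt S.carrier (L.toFun t)

/-- `∂S = L₁ ∪ L₂`: the boundary of `S` is the disjoint union of the two simple loops `L₁` and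
`L₂`, and each of them carries the orientation induced from `S`. -/
def HasBoundary (S : OrientedSurface) (L₁ L₂ : Loop) : Prop :=
  L₁.IsSimple ∧ L₂.IsSimple ∧ Disjoint L₁.image L₂.image ∧
    S.boundary = L₁.image ∪ L₂.image ∧
    S.InducesOrientationOf L₁ ∧ S.InducesOrientationOf L₂

end OrientedSurface

end GaussIntegral

namespace GaussIntegral

/-! Symmetry is Fubini's theorem: exchanging the curves reverses `l - m` and transposes two factors
of the triple product, so the integrand is unchanged.

For the second claim, `A C L` is `1 / 4π` times the circulation along `L` of the Biot–Savart field
`B(x) = ∫ E(x - m) × m' dt`, where `E(y) = y / ‖y‖ ^ 3` (`A_eq_lineIntegral`). Off `C` the field `B`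
is irrotational: because `E` is divergence free, the curl of `E(x - m) × m'` in `x` is the
derivative of `E` along `m'`, which is minus the `t`-derivative of `E(x - m(t))` and integrates to
zero over a closed loop (`curl_cross_coulomb`, `fderiv_potential_symm`). Smoothing `E` near the
origin makes `B` a `C¹` field on the whole space without changing it near `S`. Stokes' theorem on
`S` then gives equal circulations along `L` and `L'`.

Stokes' theorem (`lineIntegral_boundary_eq_zero`) is proved without a global surface integral. With
a partition of unity `ρ i` subordinate to positively oriented charts, Green's theorem in a sector
turns the circulation of `ρ i • F` into the flux of `∇ρ i × F` in chart `i`, since `F` has no curl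
there. Splitting each flux again by the `ρ j` and moving it to chart `j` (`flux_eq_flux`) collects,
in each chart, the flux of `ρ j • ((∑ i, ∇ρ i) × F)`, which vanishes because `∑ i, ρ i = 1` near
`S`. The other ingredient is that the boundary loops run through the edge of each chart once and in
the positive direction (`deriv_loop_eq`, `lineIntegral_add_eq_edgeIntegral`). -/

/-! ### Vector algebra in three-space. -/

lemma inner_eq_sum (x y : E3) : inner ℝ x y = x 0 * y 0 + x 1 * y 1 + x 2 * y 2 := by
  simp [PiLp.inner_apply, Fin.sum_univ_three]
  ring

@[simp] lemma cross_apply_zero (x y : E3) : cross x y 0 = x 1 * y 2 - x 2 * y 1 := by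
  simp [cross, cross_apply]

@[simp] lemma cross_apply_one (x y : E3) : cross x y 1 = x 2 * y 0 - x 0 * y 2 := by
  simp [cross, cross_apply]

@[simp] lemma cross_apply_two (x y : E3) : cross x y 2 = x 0 * y 1 - x 1 * y 0 := by
  simp [cross, cross_apply]

lemma ext3 {x y : E3} (h0 : x 0 = y 0) (h1 : x 1 = y 1) (h2 : x 2 = y 2) : x = y := by
  ext i
  fin_cases i
  exacts [h0, h1, h2]

/-- The cross product as a continuous bilinear map. -/
noncomputable def crossL : E3 →L[ℝ] E3 →L[ℝ] E3 :=
  LinearMap.toContinuousBilinearMap (LinearMap.mk₂ ℝ cross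
    (fun x y z => by apply ext3 <;> simp <;> ring)
    (fun a x y => by apply ext3 <;> simp <;> ring)
    (fun x y z => by apply ext3 <;> simp <;> ring)
    (fun a x y => by apply ext3 <;> simp <;> ring))

@[simp] lemma crossL_apply (x y : E3) : crossL x y = cross x y := rfl

lemma cross_sum_left {ι : Type*} (s : Finset ι) (f : ι → E3) (y : E3) :
    cross (∑ i ∈ s, f i) y = ∑ i ∈ s, cross (f i) y := by
  simp only [← crossL_apply]; simp

lemma inner_cross_cross (a b c d : E3) :
    inner ℝ (cross a b) (cross c d) =
      inner ℝ a c * inner ℝ b d - inner ℝ a d * inner ℝ b c := by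
  simp only [inner_eq_sum, cross_apply_zero, cross_apply_one, cross_apply_two]
  ring

/-- The cross product of two linear combinations of two vectors. -/
lemma cross_lincomb (a b c d : ℝ) (x y : E3) :
    cross (a • x + b • y) (c • x + d • y) = (a * d - b * c) • cross x y := by
  apply ext3 <;> simp <;> ring

/-- A vector orthogonal to `x` and `y` has the inner product with `x × y` of the
largest possible absolute value. -/
lemma inner_cross_sq_of_orthogonal {n x y : E3} (hx : inner ℝ n x = 0) (hy : inner ℝ n y = 0) :
    inner ℝ n (cross x y) ^ 2 = ‖n‖ ^ 2 * ‖cross x y‖ ^ 2 := by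
  have h : cross n (cross x y) = 0 := by
    have : cross n (cross x y) = inner ℝ n y • x - inner ℝ n x • y := by
      apply ext3 <;> simp [inner_eq_sum] <;> ring
    rw [this, hx, hy]; simp
  have h2 := inner_cross_cross n (cross x y) n (cross x y)
  rw [h, inner_zero_left, real_inner_self_eq_norm_sq, real_inner_self_eq_norm_sq,
    real_inner_comm n] at h2
  linarith [sq (inner ℝ n (cross x y))]

/-- Switching the two curves in the integrand of the Gauss integral. -/
lemma inner_cross_swap (a b c : E3) :
    inner ℝ (cross a b) c = inner ℝ (cross (-a) c) b := by
  simp [inner_eq_sum]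
  ring

/-- The inclusion of the plane `z = 0` in three-space. -/
noncomputable def incl : ℝ × ℝ →L[ℝ] E3 :=
  LinearMap.toContinuousLinearMap
    { toFun := fun u => WithLp.toLp 2 ![u.1, u.2, 0]
      map_add' := fun u v => by apply ext3 <;> simp
      map_smul' := fun a u => by apply ext3 <;> simp }

@[simp] lemma incl_apply_zero (u : ℝ × ℝ) : incl u 0 = u.1 := rfl
@[simp] lemma incl_apply_one (u : ℝ × ℝ) : incl u 1 = u.2 := rfl
@[simp] lemma incl_apply_two (u : ℝ × ℝ) : incl u 2 = 0 := rfl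

/-- The orthogonal projection of three-space to the plane `z = 0`. -/
noncomputable def plproj : E3 →L[ℝ] ℝ × ℝ :=
  (EuclideanSpace.proj 0).prod (EuclideanSpace.proj 1)

@[simp] lemma plproj_fst (x : E3) : (plproj x).1 = x 0 := rfl
@[simp] lemma plproj_snd (x : E3) : (plproj x).2 = x 1 := rfl
lemma plproj_incl (u : ℝ × ℝ) : plproj (incl u) = u := rfl

lemma incl_plproj {x : E3} (h : x 2 = 0) : incl (plproj x) = x := by
  apply ext3 <;> simp [h]

lemma isClosedEmbedding_incl : Topology.IsClosedEmbedding incl := by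
  refine incl.toLinearMap.isClosedEmbedding_of_injective ?_
  rw [LinearMap.ker_eq_bot]
  exact fun u v h => by
    have := congrArg plproj h
    exact this

/-! ### Green's theorem in a plane sector. -/

open MeasureTheory Set Filter Topology

/-- The open sector `y > c |x|`. -/
def openSector (c : ℝ) : Set (ℝ × ℝ) := {u | c * |u.1| < u.2}

lemma isOpen_openSector (c : ℝ) : IsOpen (openSector c) :=
  isOpen_lt (by fun_prop) (by fun_prop)

/-- The homeomorphism of the plane that takes the upper half plane to a sector. -/
def shear (c : ℝ) : ℝ × ℝ ≃ₜ ℝ × ℝ where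
  toFun u := (u.1, u.2 + c * |u.1|)
  invFun u := (u.1, u.2 - c * |u.1|)
  left_inv u := by simp
  right_inv u := by simp
  continuous_toFun := by fun_prop
  continuous_invFun := by fun_prop

lemma integral_Ioi_comp_add (f : ℝ → ℝ) (a : ℝ) :
    ∫ v in Ioi 0, f (v + a) = ∫ y in Ioi a, f y := by
  rw [← integral_indicator measurableSet_Ioi, ← integral_indicator measurableSet_Ioi,
    ← integral_add_right_eq_self ((Ioi a).indicator f) a]
  congr 1 with v
  simp [indicator]

/-- Fubini, with each vertical ray translated so that the sector becomes the half plane `v > 0`. -/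
lemma setIntegral_openSector (c : ℝ) {f : ℝ × ℝ → ℝ} (hf : Continuous f)
    (hc : HasCompactSupport f) :
    ∫ u in openSector c, f u = ∫ x, ∫ v in Ioi 0, f (x, v + c * |x|) := by
  have hi : Integrable f := hf.integrable_of_hasCompactSupport hc
  rw [← integral_indicator (isOpen_openSector c).measurableSet, Measure.volume_eq_prod,
    integral_prod _ (hi.indicator (isOpen_openSector c).measurableSet)]
  congr 1 with x
  rw [integral_Ioi_comp_add (fun y => f (x, y)), ← integral_indicator measurableSet_Ioi]
  congr 1

lemma hasCompactSupport_fst {f : ℝ × ℝ → ℝ} (hc : HasCompactSupport f) (x : ℝ) :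
    HasCompactSupport fun y => f (x, y) :=
  hc.comp_isClosedEmbedding (Function.LeftInverse.isClosedEmbedding (f := Prod.snd)
    (fun _ => rfl) continuous_snd (by fun_prop))

lemma hasCompactSupport_snd {f : ℝ × ℝ → ℝ} (hc : HasCompactSupport f) (y : ℝ) :
    HasCompactSupport fun x => f (x, y) :=
  hc.comp_isClosedEmbedding (Function.LeftInverse.isClosedEmbedding (f := Prod.fst)
    (fun _ => rfl) continuous_fst (by fun_prop))

/-- A continuous compactly supported function on the line, differentiable off the origin,
has a derivative of mean zero. -/
lemma integral_eq_zero_of_hasDerivAt_off_zero {q q' : ℝ → ℝ} (hq : Continuous q)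
    (hc : HasCompactSupport q) (hd : ∀ x, x ≠ 0 → HasDerivAt q (q' x) x)
    (hi : Integrable q') : ∫ x, q' x = 0 := by
  rw [← intervalIntegral.integral_Iic_add_Ioi (b := 0) hi.integrableOn hi.integrableOn]
  have h0 : Tendsto q atTop (𝓝 0) := hc.is_zero_at_infty.mono_left atTop_le_cocompact
  have h1 : Tendsto q atBot (𝓝 0) := hc.is_zero_at_infty.mono_left atBot_le_cocompact
  rw [integral_Ioi_of_hasDerivAt_of_tendsto hq.continuousWithinAt
      (fun x hx => hd x (ne_of_gt hx)) hi.integrableOn h0,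
    integral_Iic_of_hasDerivAt_of_tendsto hq.continuousWithinAt
      (fun x hx => hd x (ne_of_lt hx)) hi.integrableOn h1]
  ring

lemma measurable_const_mul_sign (c : ℝ) :
    Measurable fun x : ℝ => (c * (SignType.sign x : ℝ)) := by
  have : (fun x : ℝ => (SignType.sign x : ℝ)) =
      fun x => (Ioi (0 : ℝ)).indicator 1 x - (Iio (0 : ℝ)).indicator 1 x := by
    ext x
    rcases lt_trichotomy x 0 with h | h | h <;> simp [h, h.not_gt, indicator]
  refine measurable_const.mul ?_
  rw [this]
  exact (measurable_one.indicator measurableSet_Ioi).sub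
    (measurable_one.indicator measurableSet_Iio)

lemma norm_const_mul_sign_le (c x : ℝ) : ‖c * (SignType.sign x : ℝ)‖ ≤ |c| := by
  rw [Real.norm_eq_abs, abs_mul]
  refine mul_le_of_le_one_right (abs_nonneg c) ?_
  rcases lt_trichotomy x 0 with h | h | h <;> simp [h]

lemma setIntegral_openSector_snd (c : ℝ) {P : ℝ × ℝ → ℝ} (hP : ContDiff ℝ 1 P)
    (cP : HasCompactSupport P) :
    ∫ u in openSector c, fderiv ℝ P u (0, 1) = -∫ x, P (x, c * |x|) := by
  rw [setIntegral_openSector c ((hP.continuous_fderiv one_ne_zero).clm_apply continuous_const)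
    (cP.fderiv_apply ℝ _), ← integral_neg]
  congr 1 with x
  rw [integral_Ioi_comp_add (fun y => fderiv ℝ P (x, y) (0, 1)),
    ← HasCompactSupport.integral_Ioi_deriv_eq (f := fun y => P (x, y)) (by fun_prop)
      (hasCompactSupport_fst cP x)]
  congr 1 with y
  have h1 : HasDerivAt (fun y : ℝ => (x, y)) (0, 1) y :=
    (hasDerivAt_const y x).prodMk (hasDerivAt_id y)
  exact (((hP.differentiable one_ne_zero (x, y)).hasFDerivAt.comp_hasDerivAt y h1).deriv).symm

/-- Differentiating `Q` along the translate `x ↦ (x, v + c |x|)` of the edge gives `∂₁Q + c sign(x)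
∂₂Q`, which has mean zero for fixed `v`. Integrating over `v > 0` trades the `∂₁Q` term for the
`∂₂Q` term, which the fundamental theorem on vertical rays evaluates on the edge. -/
lemma setIntegral_openSector_fst (c : ℝ) {Q : ℝ × ℝ → ℝ} (hQ : ContDiff ℝ 1 Q)
    (cQ : HasCompactSupport Q) :
    ∫ u in openSector c, fderiv ℝ Q u (1, 0) =
      ∫ x, c * (SignType.sign x : ℝ) * Q (x, c * |x|) := by
  set f : ℝ × ℝ → ℝ := fun u => fderiv ℝ Q u (1, 0) with hf
  set g : ℝ × ℝ → ℝ := fun u => fderiv ℝ Q u (0, 1) with hg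
  have fc : Continuous f := (hQ.continuous_fderiv one_ne_zero).clm_apply continuous_const
  have gc : Continuous g := (hQ.continuous_fderiv one_ne_zero).clm_apply continuous_const
  have fs : HasCompactSupport f := cQ.fderiv_apply ℝ _
  have gs : HasCompactSupport g := cQ.fderiv_apply ℝ _
  have fi : Integrable (fun u : ℝ × ℝ => f (u.1, u.2 + c * |u.1|)) :=
    (fc.comp (shear c).continuous).integrable_of_hasCompactSupport (fs.comp_homeomorph (shear c))
  have gi : Integrable (fun u : ℝ × ℝ => g (u.1, u.2 + c * |u.1|)) :=
    (gc.comp (shear c).continuous).integrable_of_hasCompactSupport (gs.comp_homeomorph (shear c))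
  have gi' : Integrable
      (fun u : ℝ × ℝ => (c * (SignType.sign u.1 : ℝ)) * g (u.1, u.2 + c * |u.1|)) := by
    refine gi.bdd_mul (c := |c|)
      ((measurable_const_mul_sign c).comp measurable_fst).aestronglyMeasurable
      (Eventually.of_forall fun u => ?_)
    exact norm_const_mul_sign_le c u.1
  have restr {h : ℝ × ℝ → ℝ} (hi : Integrable h) :
      Integrable h ((volume : Measure ℝ).prod (volume.restrict (Ioi 0))) := by
    have := hi.restrict (s := univ ×ˢ Ioi (0 : ℝ))
    rwa [Measure.volume_eq_prod, ← Measure.prod_restrict, Measure.restrict_univ] at this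
  have key (v : ℝ) (hv : Integrable fun x => f (x, v + c * |x|) +
      c * (SignType.sign x : ℝ) * g (x, v + c * |x|)) :
      ∫ x, (f (x, v + c * |x|) + c * (SignType.sign x : ℝ) * g (x, v + c * |x|)) = 0 := by
    refine integral_eq_zero_of_hasDerivAt_off_zero (q := fun x => Q (x, v + c * |x|))
      (hQ.continuous.comp (by fun_prop))
      (hasCompactSupport_snd (cQ.comp_homeomorph (shear c)) v) (fun x hx => ?_) hv
    have h1 : HasDerivAt (fun x : ℝ => (x, v + c * |x|)) (1, c * (SignType.sign x : ℝ)) x :=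
      (hasDerivAt_id x).prodMk (((hasDerivAt_abs hx).const_mul c).const_add v)
    have h2 := (hQ.differentiable one_ne_zero (x, v + c * |x|)).hasFDerivAt.comp_hasDerivAt x h1
    have e1 : ((1 : ℝ), c * (SignType.sign x : ℝ)) =
      (1, 0) + (c * (SignType.sign x : ℝ)) • ((0 : ℝ), (1 : ℝ)) := by simp
    have e2 : f (x, v + c * |x|) + c * (SignType.sign x : ℝ) * g (x, v + c * |x|) =
        fderiv ℝ Q (x, v + c * |x|) (1, c * (SignType.sign x : ℝ)) := by
      rw [e1, map_add, map_smul, smul_eq_mul]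
    rw [e2]
    exact h2
  have tot := restr (fi.add gi')
  have hsum : ∫ x, ∫ v in Ioi 0, (f (x, v + c * |x|) +
      c * (SignType.sign x : ℝ) * g (x, v + c * |x|)) = 0 := by
    rw [integral_integral_swap tot]
    rw [integral_congr_ae (g := fun _ => (0 : ℝ)), integral_zero]
    filter_upwards [tot.prod_left_ae] with v hv using key v hv
  rw [setIntegral_openSector c fc fs]
  have e : ∀ x, ∫ v in Ioi 0, c * (SignType.sign x : ℝ) * g (x, v + c * |x|) =
      -(c * (SignType.sign x : ℝ) * Q (x, c * |x|)) := fun x => by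
    rw [integral_const_mul, integral_Ioi_comp_add (fun y => g (x, y)), ← mul_neg,
      ← HasCompactSupport.integral_Ioi_deriv_eq (f := fun y => Q (x, y)) (by fun_prop)
        (hasCompactSupport_fst cQ x)]
    congr 2 with y
    have h1 : HasDerivAt (fun y : ℝ => (x, y)) (0, 1) y :=
      (hasDerivAt_const y x).prodMk (hasDerivAt_id y)
    exact (((hQ.differentiable one_ne_zero (x, y)).hasFDerivAt.comp_hasDerivAt y h1).deriv).symm
  have hsplit : ∫ x, ∫ v in Ioi 0, (f (x, v + c * |x|) +
      c * (SignType.sign x : ℝ) * g (x, v + c * |x|)) =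
      (∫ x, ∫ v in Ioi 0, f (x, v + c * |x|)) +
        ∫ x, ∫ v in Ioi 0, c * (SignType.sign x : ℝ) * g (x, v + c * |x|) :=
    integral_integral_add (restr fi) (restr gi')
  rw [hsplit] at hsum
  simp only [e, integral_neg] at hsum
  linarith

/-- Green's theorem in a sector. -/
theorem green_openSector (c : ℝ) {P Q : ℝ × ℝ → ℝ} (hP : ContDiff ℝ 1 P) (hQ : ContDiff ℝ 1 Q)
    (cP : HasCompactSupport P) (cQ : HasCompactSupport Q) :
    ∫ u in openSector c, (fderiv ℝ Q u (1, 0) - fderiv ℝ P u (0, 1)) =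
      (∫ x, P (x, c * |x|)) + ∫ x, c * (SignType.sign x : ℝ) * Q (x, c * |x|) := by
  have hi {h : ℝ × ℝ → ℝ} (hh : ContDiff ℝ 1 h) (ch : HasCompactSupport h) (v : ℝ × ℝ) :
      Integrable fun u => fderiv ℝ h u v :=
    ((hh.continuous_fderiv one_ne_zero).clm_apply continuous_const).integrable_of_hasCompactSupport
      (ch.fderiv_apply ℝ _)
  rw [integral_sub (hi hQ cQ _).integrableOn (hi hP cP _).integrableOn,
    setIntegral_openSector_fst c hQ cQ, setIntegral_openSector_snd c hP cP]
  ring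

/-! ### Charts and the parametrizations they induce. -/

section Diffeo

variable {Φ : OpenPartialHomeomorph E3 E3}

/-- The parametrization of the preimage of the plane `z = 0` under a chart. -/
noncomputable def param (Φ : OpenPartialHomeomorph E3 E3) (u : ℝ × ℝ) : E3 := Φ.symm (incl u)

/-- The domain of the parametrization given by a chart. -/
def dom (Φ : OpenPartialHomeomorph E3 E3) : Set (ℝ × ℝ) := incl ⁻¹' Φ.target

lemma isOpen_dom (Φ : OpenPartialHomeomorph E3 E3) : IsOpen (dom Φ) :=
  Φ.open_target.preimage incl.continuous

lemma param_mem_source {u : ℝ × ℝ} (hu : u ∈ dom Φ) : param Φ u ∈ Φ.source := Φ.map_target hu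

lemma chart_param {u : ℝ × ℝ} (hu : u ∈ dom Φ) : Φ (param Φ u) = incl u := Φ.right_inv hu

lemma plproj_chart_param {u : ℝ × ℝ} (hu : u ∈ dom Φ) : plproj (Φ (param Φ u)) = u := by
  rw [chart_param hu, plproj_incl]

lemma injOn_param (Φ : OpenPartialHomeomorph E3 E3) : InjOn (param Φ) (dom Φ) := by
  intro u hu v hv h
  rw [← plproj_chart_param hu, h, plproj_chart_param hv]

lemma plproj_mem_dom {x : E3} (hx : x ∈ Φ.source) (h : Φ x 2 = 0) : plproj (Φ x) ∈ dom Φ := by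
  change incl (plproj (Φ x)) ∈ Φ.target
  rw [incl_plproj h]
  exact Φ.map_source hx

lemma param_plproj {x : E3} (hx : x ∈ Φ.source) (h : Φ x 2 = 0) : param Φ (plproj (Φ x)) = x := by
  rw [param, incl_plproj h, Φ.left_inv hx]

lemma IsC2Diffeo.contDiffAt (hΦ : IsC2Diffeo Φ) {x : E3} (hx : x ∈ Φ.source) :
    ContDiffAt ℝ 2 Φ x :=
  hΦ.1.contDiffAt (Φ.open_source.mem_nhds hx)

lemma IsC2Diffeo.hasFDerivAt (hΦ : IsC2Diffeo Φ) {x : E3} (hx : x ∈ Φ.source) :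
    HasFDerivAt Φ (fderiv ℝ Φ x) x :=
  ((hΦ.contDiffAt hx).differentiableAt two_ne_zero).hasFDerivAt

lemma IsC2Diffeo.contDiffAt_param (hΦ : IsC2Diffeo Φ) {u : ℝ × ℝ} (hu : u ∈ dom Φ) :
    ContDiffAt ℝ 2 (param Φ) u :=
  (hΦ.2.contDiffAt (Φ.open_target.mem_nhds hu)).comp u incl.contDiff.contDiffAt

lemma IsC2Diffeo.hasFDerivAt_param (hΦ : IsC2Diffeo Φ) {u : ℝ × ℝ} (hu : u ∈ dom Φ) :
    HasFDerivAt (param Φ) (fderiv ℝ (param Φ) u) u :=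
  ((hΦ.contDiffAt_param hu).differentiableAt two_ne_zero).hasFDerivAt

lemma IsC2Diffeo.continuousOn_param (hΦ : IsC2Diffeo Φ) : ContinuousOn (param Φ) (dom Φ) :=
  fun _ hu => (hΦ.hasFDerivAt_param hu).continuousAt.continuousWithinAt

lemma IsC2Diffeo.fderiv_chart_param (hΦ : IsC2Diffeo Φ) {u : ℝ × ℝ} (hu : u ∈ dom Φ)
    (v : ℝ × ℝ) : fderiv ℝ Φ (param Φ u) (fderiv ℝ (param Φ) u v) = incl v := by
  have h1 : HasFDerivAt (Φ ∘ param Φ) _ u :=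
    (hΦ.hasFDerivAt (param_mem_source hu)).comp u (hΦ.hasFDerivAt_param hu)
  have h2 : HasFDerivAt (Φ ∘ param Φ) incl u := by
    refine incl.hasFDerivAt.congr_of_eventuallyEq ?_
    filter_upwards [(isOpen_dom Φ).mem_nhds hu] with w hw using chart_param hw
  exact congrArg (fun f => f v) (h1.unique h2)

lemma IsC2Diffeo.fderiv_injective (hΦ : IsC2Diffeo Φ) {x : E3} (hx : x ∈ Φ.source) :
    Function.Injective (fderiv ℝ Φ x) := by
  have hs : DifferentiableAt ℝ Φ.symm (Φ x) :=
    (hΦ.2.contDiffAt (Φ.open_target.mem_nhds (Φ.map_source hx))).differentiableAt two_ne_zero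
  have h1 : HasFDerivAt (Φ.symm ∘ Φ) _ x := hs.hasFDerivAt.comp x (hΦ.hasFDerivAt hx)
  have h2 : HasFDerivAt (Φ.symm ∘ Φ) (ContinuousLinearMap.id ℝ E3) x := by
    refine (hasFDerivAt_id x).congr_of_eventuallyEq ?_
    filter_upwards [Φ.open_source.mem_nhds hx] with w hw using Φ.left_inv hw
  have h3 := h1.unique h2
  refine Function.LeftInverse.injective (g := fderiv ℝ Φ.symm (Φ x)) fun v => ?_
  exact congrArg (fun f => f v) h3

lemma IsC2Diffeo.fderiv_param_plproj (hΦ : IsC2Diffeo Φ) {u : ℝ × ℝ} (hu : u ∈ dom Φ) {w : E3}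
    (hw : fderiv ℝ Φ (param Φ u) w 2 = 0) :
    fderiv ℝ (param Φ) u (plproj (fderiv ℝ Φ (param Φ u) w)) = w := by
  apply hΦ.fderiv_injective (param_mem_source hu)
  rw [hΦ.fderiv_chart_param hu, incl_plproj hw]

/-- If `X × Y = 0`, expanding `Y × (X × Y)` gives `‖Y‖² X = (X · Y) Y`. The chart derivative sends
`X` and `Y` to the first two basis vectors, so the first coordinate forces `Y = 0`, a contradiction.
-/
lemma IsC2Diffeo.cross_ne_zero (hΦ : IsC2Diffeo Φ) {u : ℝ × ℝ} (hu : u ∈ dom Φ) :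
    cross (fderiv ℝ (param Φ) u (1, 0)) (fderiv ℝ (param Φ) u (0, 1)) ≠ 0 := by
  set X := fderiv ℝ (param Φ) u (1, 0) with hX
  set Y := fderiv ℝ (param Φ) u (0, 1) with hY
  intro h
  have h1 : inner ℝ Y Y • X - inner ℝ X Y • Y = cross Y (cross X Y) := by
    apply ext3 <;> simp only [PiLp.sub_apply, PiLp.smul_apply, smul_eq_mul, cross_apply_zero,
      cross_apply_one, cross_apply_two, inner_eq_sum] <;> ring
  rw [h, ← crossL_apply, map_zero] at h1
  have h2 := congrArg (fun v => fderiv ℝ Φ (param Φ u) v 0) h1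
  simp only [map_sub, map_smul, hX, hY, hΦ.fderiv_chart_param hu, map_zero] at h2
  simp only [PiLp.sub_apply, PiLp.smul_apply, incl_apply_zero, smul_eq_mul, PiLp.zero_apply,
    mul_one, mul_zero, sub_zero, inner_self_eq_zero] at h2
  have h3 := congrArg (fun v => v 1) (hΦ.fderiv_chart_param hu (0, 1))
  simp [h2] at h3

lemma IsC2Diffeo.restrOpen (hΦ : IsC2Diffeo Φ) {U : Set E3} (hU : IsOpen U) :
    IsC2Diffeo (Φ.restrOpen U hU) :=
  ⟨hΦ.1.mono inter_subset_left, hΦ.2.mono inter_subset_left⟩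

lemma IsC2Diffeo.transHomeomorph (hΦ : IsC2Diffeo Φ) {e : E3 ≃ₜ E3} (he : ContDiff ℝ 2 e)
    (he' : ContDiff ℝ 2 e.symm) : IsC2Diffeo (Φ.transHomeomorph e) :=
  ⟨he.comp_contDiffOn hΦ.1, hΦ.2.comp he'.contDiffOn fun _ hx => hx⟩

end Diffeo

/-! ### Interior points, boundary points and sector charts. -/

/-- The affine map `(x, y, z) ↦ (a x + b, y + d x + e, z)`. -/
noncomputable def affineMapE3 (a b d e : ℝ) (x : E3) : E3 :=
  WithLp.toLp 2 ![a * x 0 + b, x 1 + d * x 0 + e, x 2]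

lemma contDiff_affineMapE3 (a b d e : ℝ) {n : WithTop ℕ∞} : ContDiff ℝ n (affineMapE3 a b d e) := by
  have h (i : Fin 3) : ContDiff ℝ n fun x : E3 => x i := (EuclideanSpace.proj (𝕜 := ℝ) i).contDiff
  rw [contDiff_euclidean]
  intro i
  fin_cases i
  · exact (contDiff_const.mul (h 0)).add contDiff_const
  · exact ((h 1).add (contDiff_const.mul (h 0))).add contDiff_const
  · exact h 2

/-- The affine homeomorphism `(x, y, z) ↦ (a x + b, y + d x + e, z)`, where `a = ± 1`. -/
noncomputable def affineHomeo (a b d e : ℝ) (ha : a * a = 1) : E3 ≃ₜ E3 where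
  toFun := affineMapE3 a b d e
  invFun := affineMapE3 a (-(a * b)) (-(d * a)) (d * a * b - e)
  left_inv x := by
    apply ext3 <;> simp [affineMapE3]
    · linear_combination x 0 * ha
    · linear_combination -(d * x 0) * ha
  right_inv x := by
    apply ext3 <;> simp [affineMapE3]
    · linear_combination (x 0 - b) * ha
    · ring
  continuous_toFun := (contDiff_affineMapE3 (n := 0) ..).continuous
  continuous_invFun := (contDiff_affineMapE3 (n := 0) ..).continuous

lemma IsC2Diffeo.affine {Φ : OpenPartialHomeomorph E3 E3} (hΦ : IsC2Diffeo Φ) (a b d e : ℝ)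
    (ha : a * a = 1) : IsC2Diffeo (Φ.transHomeomorph (affineHomeo a b d e ha)) :=
  hΦ.transHomeomorph (contDiff_affineMapE3 ..) (contDiff_affineMapE3 ..)

/-- A point of a surface cannot be both interior and a boundary point. -/
lemma not_isInteriorPoint_of_isBoundaryPoint {S : Set E3} {p : E3} (hb : IsBoundaryPoint S p) :
    ¬ IsInteriorPoint S p := by
  rintro ⟨Φ, hΦ, hpΦ, hSΦ⟩
  obtain ⟨c, Ψ, hΨ, hpΨ, hΨp, hSΨ⟩ := hb
  have zero_mem : (0 : ℝ × ℝ) ∈ dom Ψ := by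
    change incl 0 ∈ Ψ.target
    rw [map_zero, ← hΨp]
    exact Ψ.map_source hpΨ
  have param0 : param Ψ 0 = p := by rw [param, map_zero, ← hΨp, Ψ.left_inv hpΨ]
  have hpS : p ∈ S := (hSΨ p hpΨ).2 (by simp [hΨp])
  have hp2 : Φ p 2 = 0 := (hSΦ p hpΦ).1 hpS
  -- The velocity `w` points from `p` into the sector. If `p` were interior, a curve in `S` could
  -- pass through `p` with velocity `w` in both directions, and so would leave the sector backwards.
  set w := fderiv ℝ (param Ψ) 0 (0, 1) with hw
  have line (v : ℝ × ℝ) (u : ℝ × ℝ) : HasDerivAt (fun t : ℝ => u + t • v) v 0 := by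
    simpa using ((hasDerivAt_id (0 : ℝ)).smul_const v).const_add u
  have d1 : HasDerivAt (fun t : ℝ => param Ψ (0 + t • (0, 1))) w 0 := by
    have h : HasFDerivAt (param Ψ) (fderiv ℝ (param Ψ) 0)
        ((0 : ℝ × ℝ) + (0 : ℝ) • ((0 : ℝ), (1 : ℝ))) := by
      simpa using hΨ.hasFDerivAt_param zero_mem
    exact h.comp_hasDerivAt (0 : ℝ) (line (0, 1) 0)
  have d2 : HasDerivAt (fun t : ℝ => Φ (param Ψ (0 + t • (0, 1))) 2) (fderiv ℝ Φ p w 2) 0 := by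
    have : HasDerivAt (fun t : ℝ => Φ (param Ψ (0 + t • (0, 1)))) (fderiv ℝ Φ p w) 0 := by
      have h : HasFDerivAt Φ (fderiv ℝ Φ p)
          (param Ψ ((0 : ℝ × ℝ) + (0 : ℝ) • ((0 : ℝ), (1 : ℝ)))) := by
        simpa [param0] using hΦ.hasFDerivAt hpΦ
      exact h.comp_hasDerivAt (0 : ℝ) d1
    exact (EuclideanSpace.proj (𝕜 := ℝ) (2 : Fin 3)).hasFDerivAt.comp_hasDerivAt (0 : ℝ) this
  -- For `t ≥ 0` the curve stays in `S`, where the third coordinate of `Φ` vanishes; a one-sided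
  -- derivative suffices.
  have hw2 : fderiv ℝ Φ p w 2 = 0 := by
    refine (uniqueDiffWithinAt_Ici (0 : ℝ)).eq_deriv _ (d2.hasDerivWithinAt (s := Ici 0)) ?_
    refine (hasDerivWithinAt_const (0 : ℝ) (Ici 0) (0 : ℝ)).congr_of_eventuallyEq ?_ ?_
    · have c1 : ContinuousAt (fun t : ℝ => ((0 : ℝ × ℝ) + t • ((0 : ℝ), (1 : ℝ)))) 0 := by fun_prop
      have e1 : ∀ᶠ t : ℝ in 𝓝 0, (0 : ℝ × ℝ) + t • ((0 : ℝ), (1 : ℝ)) ∈ dom Ψ :=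
        c1.eventually_mem ((isOpen_dom Ψ).mem_nhds (by simpa using zero_mem))
      have e2 : ∀ᶠ t : ℝ in 𝓝 0, param Ψ (0 + t • (0, 1)) ∈ Φ.source :=
        d1.continuousAt.eventually_mem (Φ.open_source.mem_nhds (by simpa [param0] using hpΦ))
      filter_upwards [nhdsWithin_le_nhds e1, nhdsWithin_le_nhds e2, self_mem_nhdsWithin]
        with t h1 h2 h3
      refine (hSΦ _ h2).1 ((hSΨ _ (param_mem_source h1)).2 ?_)
      rw [chart_param h1]
      simpa using h3
    · simpa [param0] using hp2
  set u := plproj (Φ p) with hu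
  have hud : u ∈ dom Φ := plproj_mem_dom hpΦ hp2
  have hup : param Φ u = p := param_plproj hpΦ hp2
  set v := plproj (fderiv ℝ Φ p w)
  have hv : fderiv ℝ (param Φ) u v = w := by
    have := hΦ.fderiv_param_plproj hud (w := w)
    rw [hup] at this
    exact this hw2
  have d3 : HasDerivAt (fun t : ℝ => param Φ (u + t • v)) w 0 := by
    rw [← hv]
    have h : HasFDerivAt (param Φ) (fderiv ℝ (param Φ) u) (u + (0 : ℝ) • v) := by
      simpa using hΦ.hasFDerivAt_param hud
    exact h.comp_hasDerivAt (0 : ℝ) (line v u)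
  have d4 : HasDerivAt (fun t : ℝ => Ψ (param Φ (u + t • v))) (incl (0, 1)) 0 := by
    have : fderiv ℝ Ψ p w = incl (0, 1) := by
      have := hΨ.fderiv_chart_param zero_mem (0, 1)
      rwa [param0] at this
    rw [← this]
    have h : HasFDerivAt Ψ (fderiv ℝ Ψ p) (param Φ (u + (0 : ℝ) • v)) := by
      simpa [hup] using hΨ.hasFDerivAt hpΨ
    exact h.comp_hasDerivAt (0 : ℝ) d3
  have comp (i : Fin 3) :
      HasDerivAt (fun t : ℝ => Ψ (param Φ (u + t • v)) i) (incl (0, 1) i) 0 :=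
    (EuclideanSpace.proj (𝕜 := ℝ) i).hasFDerivAt.comp_hasDerivAt (0 : ℝ) d4
  -- The first coordinate is `o(t)`, so its absolute value is differentiable at `0` even though
  -- `|·|` is not.
  have d5 : HasDerivAt (fun t : ℝ => |Ψ (param Φ (u + t • v)) 0|) 0 0 := by
    have := (hasDerivAt_iff_isLittleO.1 (comp 0)).abs_left
    rw [hasDerivAt_iff_isLittleO]
    simpa [hup, hΨp] using this
  have d6 := (comp 1).sub (d5.const_mul c)
  -- Lying in the sector makes this function nonnegative, with value `0` at `t = 0`; but its
  -- derivative there is `1`.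
  have hmin : IsLocalMin
      (fun t : ℝ => Ψ (param Φ (u + t • v)) 1 - c * |Ψ (param Φ (u + t • v)) 0|) 0 := by
    have c1 : ContinuousAt (fun t : ℝ => u + t • v) 0 := by fun_prop
    have e1 : ∀ᶠ t : ℝ in 𝓝 0, u + t • v ∈ dom Φ :=
      c1.eventually_mem ((isOpen_dom Φ).mem_nhds (by simpa using hud))
    have e2 : ∀ᶠ t : ℝ in 𝓝 0, param Φ (u + t • v) ∈ Ψ.source :=
      d3.continuousAt.eventually_mem (Ψ.open_source.mem_nhds (by simpa [hup] using hpΨ))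
    filter_upwards [e1, e2] with t h1 h2
    have h3 := ((hSΨ _ h2).1 ((hSΦ _ (param_mem_source h1)).2 (by simp [chart_param h1]))).2
    simpa [hup, hΨp] using h3
  have := hmin.hasDerivAt_eq_zero d6
  simp at this

/-- A `C²` diffeomorphism that takes the set `M` to a sector `z = 0`, `y ≥ c |x|`. Contrary to
the definition of a boundary point, the chart need not be centred at the vertex, which may even
lie outside the image of the chart. -/
structure IsSectorChart (M : Set E3) (c : ℝ) (Φ : OpenPartialHomeomorph E3 E3) : Prop where
  diffeo : IsC2Diffeo Φ
  mem_iff : ∀ x ∈ Φ.source, (x ∈ M ↔ Φ x 2 = 0 ∧ c * |Φ x 0| ≤ Φ x 1)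

namespace IsSectorChart

variable {M : Set E3} {c : ℝ} {Φ : OpenPartialHomeomorph E3 E3}

lemma restrOpen (h : IsSectorChart M c Φ) {U : Set E3} (hU : IsOpen U) :
    IsSectorChart M c (Φ.restrOpen U hU) :=
  ⟨h.diffeo.restrOpen hU, fun x hx => h.mem_iff x hx.1⟩

lemma param_mem_iff (h : IsSectorChart M c Φ) {u : ℝ × ℝ} (hu : u ∈ dom Φ) :
    param Φ u ∈ M ↔ c * |u.1| ≤ u.2 := by
  rw [h.mem_iff _ (param_mem_source hu), chart_param hu]
  simp

lemma isInteriorPoint (h : IsSectorChart M c Φ) {x : E3} (hx : x ∈ Φ.source)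
    (hlt : c * |Φ x 0| < Φ x 1) : IsInteriorPoint M x := by
  have hU : IsOpen {y : E3 | c * |y 0| < y 1} := isOpen_lt (by fun_prop) (by fun_prop)
  have hV := Φ.isOpen_inter_preimage hU
  refine ⟨Φ.restrOpen _ hV, h.diffeo.restrOpen hV, ⟨hx, hx, hlt⟩, fun y hy => ?_⟩
  have hlt' : c * |Φ y 0| < Φ y 1 := hy.2.2
  rw [h.mem_iff y hy.1]
  exact and_iff_left hlt'.le

/-- At the vertex the chart itself serves. Away from it only one of the rays `y = ± c x` is visible
nearby, and a shear followed by a translation straightens it to the edge of a half plane. -/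
lemma isBoundaryPoint (h : IsSectorChart M c Φ) {x : E3} (hx : x ∈ Φ.source)
    (hz : Φ x 2 = 0) (heq : c * |Φ x 0| = Φ x 1) : IsBoundaryPoint M x := by
  rcases eq_or_ne (Φ x 0) 0 with h0 | h0
  · refine ⟨c, Φ, h.diffeo, hx, ?_, h.mem_iff⟩
    apply ext3
    · simpa using h0
    · simpa [h0] using heq.symm
    · simpa using hz
  obtain ⟨s, hs1, hs2⟩ : ∃ s : ℝ, s * Φ x 0 > 0 ∧ ∀ r : ℝ, s * r > 0 → |r| = s * r := by
    rcases lt_or_gt_of_ne h0 with h0 | h0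
    · exact ⟨-1, by linarith, fun r hr => by rw [abs_of_neg (by linarith)]; ring⟩
    · exact ⟨1, by linarith, fun r hr => by rw [abs_of_pos (by linarith)]; ring⟩
  have hU : IsOpen {y : E3 | s * y 0 > 0} := isOpen_lt (by fun_prop) (by fun_prop)
  have hV := Φ.isOpen_inter_preimage hU
  refine ⟨0, (Φ.restrOpen _ hV).transHomeomorph
    (affineHomeo 1 (-Φ x 0) (-(c * s)) 0 (one_mul 1)),
    (h.diffeo.restrOpen hV).affine _ _ _ _ _, ⟨hx, hx, hs1⟩, ?_, fun y hy => ?_⟩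
  · apply ext3
    · simp [affineHomeo, affineMapE3]
    · simp [affineHomeo, affineMapE3, ← heq, hs2 _ hs1, mul_assoc]
    · simp [affineHomeo, affineMapE3, hz]
  · have hy' : s * Φ y 0 > 0 := hy.2.2
    rw [h.mem_iff y hy.1, hs2 _ hy']
    simp [affineHomeo, affineMapE3, mul_assoc]

lemma isBoundaryPoint_iff (h : IsSectorChart M c Φ) {x : E3} (hx : x ∈ Φ.source)
    (hxM : x ∈ M) : IsBoundaryPoint M x ↔ c * |Φ x 0| = Φ x 1 := by
  obtain ⟨hz, hle⟩ := (h.mem_iff x hx).1 hxM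
  refine ⟨fun hb => hle.eq_of_not_lt fun hlt => ?_, h.isBoundaryPoint hx hz⟩
  exact not_isInteriorPoint_of_isBoundaryPoint hb (h.isInteriorPoint hx hlt)

end IsSectorChart

/-- An interior chart becomes a sector chart with `c = 0` once it is translated to give `p` the
coordinate `y = 1` and is restricted to `y > 0`. All points are then treated uniformly. -/
lemma OrientedSurface.exists_isSectorChart (S : OrientedSurface) {p : E3} (hp : p ∈ S.carrier) :
    ∃ c Φ, IsSectorChart S.carrier c Φ ∧ p ∈ Φ.source := by
  rcases S.isSurface p hp with ⟨Φ, hΦ, hpΦ, hS⟩ | ⟨c, Φ, hΦ, hpΦ, -, hS⟩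
  · have hU : IsOpen {y : E3 | 0 < y 1 + (1 - Φ p 1)} := isOpen_lt (by fun_prop) (by fun_prop)
    have hV := Φ.isOpen_inter_preimage hU
    refine ⟨0, (Φ.restrOpen _ hV).transHomeomorph (affineHomeo 1 0 0 (1 - Φ p 1) (one_mul 1)),
      ⟨(hΦ.restrOpen hV).affine _ _ _ _ _, fun x hx => ?_⟩, ⟨hpΦ, hpΦ, by simp⟩⟩
    have hx' : 0 < Φ x 1 + (1 - Φ p 1) := hx.2.2
    rw [hS x hx.1]
    simpa [affineHomeo, affineMapE3] using fun _ => hx'.le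
  · exact ⟨c, Φ, ⟨hΦ, hS⟩, hpΦ⟩

/-! ### Orientation: area vectors and positive charts. -/

/-- The vector `∂ψ/∂x × ∂ψ/∂y` for the parametrization `ψ` given by a chart. -/
noncomputable def areaVec (Φ : OpenPartialHomeomorph E3 E3) (u : ℝ × ℝ) : E3 :=
  cross (fderiv ℝ (param Φ) u (1, 0)) (fderiv ℝ (param Φ) u (0, 1))

lemma IsC2Diffeo.contDiffAt_fderiv_param {Φ : OpenPartialHomeomorph E3 E3} (hΦ : IsC2Diffeo Φ)
    {u : ℝ × ℝ} (hu : u ∈ dom Φ) : ContDiffAt ℝ 1 (fderiv ℝ (param Φ)) u :=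
  (hΦ.contDiffAt_param hu).fderiv_right (by norm_num)

lemma IsC2Diffeo.continuousAt_areaVec {Φ : OpenPartialHomeomorph E3 E3} (hΦ : IsC2Diffeo Φ)
    {u : ℝ × ℝ} (hu : u ∈ dom Φ) : ContinuousAt (areaVec Φ) u := by
  have h := (hΦ.contDiffAt_fderiv_param hu).continuousAt
  change ContinuousAt (fun u => crossL (fderiv ℝ (param Φ) u (1, 0))
    (fderiv ℝ (param Φ) u (0, 1))) u
  exact (crossL.continuous.continuousAt.comp (h.clm_apply continuousAt_const)).clm_apply
    (h.clm_apply continuousAt_const)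

/-- At an edge point orthogonality is known only for directions pointing into the sector. The
directions `(0, 1)` and `(1, |c|)` stay in the closed sector from any of its points, for either sign
of `c`, and they span the plane. -/
lemma inner_normal_fderiv_param {S : OrientedSurface} {c : ℝ}
    {Φ : OpenPartialHomeomorph E3 E3} (h : IsSectorChart S.carrier c Φ) {u : ℝ × ℝ}
    (hu : u ∈ dom Φ) (hc : c * |u.1| ≤ u.2) (v : ℝ × ℝ) :
    inner ℝ (S.normal (param Φ u)) (fderiv ℝ (param Φ) u v) = 0 := by
  set K : Set (ℝ × ℝ) := dom Φ ∩ {w | c * |w.1| ≤ w.2}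
  have key (w : ℝ × ℝ) (hw : ∀ t : ℝ, 0 < t → c * |(u + t • w).1| ≤ (u + t • w).2) :
      inner ℝ (S.normal (param Φ u)) (fderiv ℝ (param Φ) u w) = 0 := by
    refine S.normal_orthogonal _ ((h.param_mem_iff hu).2 hc) _ ?_
    have h1 : w ∈ posTangentConeAt K u := by
      refine mem_posTangentConeAt_of_frequently_mem (Eventually.frequently ?_)
      have c1 : ContinuousAt (fun t : ℝ => u + t • w) 0 := by fun_prop
      have e1 : ∀ᶠ t : ℝ in 𝓝 0, u + t • w ∈ dom Φ :=
        c1.eventually_mem ((isOpen_dom Φ).mem_nhds (by simpa using hu))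
      filter_upwards [nhdsWithin_le_nhds e1, self_mem_nhdsWithin] with t ht ht'
        using ⟨ht, hw t ht'⟩
    have h2 := (h.diffeo.hasFDerivAt_param hu).hasFDerivWithinAt.mapsTo_tangent_cone
      (tangentConeAt_mono_field (𝕜' := ℝ) h1)
    refine tangentConeAt_mono ?_ h2
    rintro _ ⟨w, hw, rfl⟩
    exact (h.param_mem_iff hw.1).2 hw.2
  have k1 := key (0, 1) fun t ht => by simpa using by linarith
  have k2 := key (1, |c|) fun t ht => by
    simp only [Prod.fst_add, Prod.smul_fst, smul_eq_mul, mul_one, Prod.snd_add, Prod.smul_snd]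
    have a1 : |u.1 + t| ≤ |u.1| + t := by simpa [abs_of_pos ht] using abs_add_le u.1 t
    have a2 : |u.1| ≤ |u.1 + t| + t := by
      simpa [abs_of_pos ht] using abs_sub (u.1 + t) t
    rcases le_total 0 c with h0 | h0
    · rw [abs_of_nonneg h0]
      nlinarith
    · rw [abs_of_nonpos h0]
      nlinarith
  have e : v = v.1 • ((1 : ℝ), |c|) + (v.2 - |c| * v.1) • ((0 : ℝ), (1 : ℝ)) := by
    ext <;> simp
    ring
  rw [e, map_add, map_smul, map_smul, inner_add_right, inner_smul_right, inner_smul_right, k1, k2]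
  simp

/-- A chart whose parametrization of the surface is positively oriented. -/
structure IsPositiveChart (S : OrientedSurface) (c : ℝ) (Φ : OpenPartialHomeomorph E3 E3) : Prop
    extends IsSectorChart S.carrier c Φ where
  pos : ∀ u ∈ dom Φ, c * |u.1| ≤ u.2 → 0 < inner ℝ (S.normal (param Φ u)) (areaVec Φ u)

/-- The unit normal is orthogonal to both factors of the area vector, hence parallel to it, and the
area vector is nonzero. -/
lemma inner_normal_areaVec_ne_zero {S : OrientedSurface} {c : ℝ}
    {Φ : OpenPartialHomeomorph E3 E3} (h : IsSectorChart S.carrier c Φ) {u : ℝ × ℝ}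
    (hu : u ∈ dom Φ) (hc : c * |u.1| ≤ u.2) :
    inner ℝ (S.normal (param Φ u)) (areaVec Φ u) ≠ 0 := by
  intro h0
  have h1 := inner_cross_sq_of_orthogonal (inner_normal_fderiv_param h hu hc (1, 0))
    (inner_normal_fderiv_param h hu hc (0, 1))
  rw [S.norm_normal _ ((h.param_mem_iff hu).2 hc)] at h1
  change inner ℝ (S.normal (param Φ u)) (areaVec Φ u) ^ 2 = _ at h1
  rw [h0] at h1
  refine norm_ne_zero_iff.2 (h.diffeo.cross_ne_zero hu) (pow_eq_zero_iff two_ne_zero |>.1 ?_)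
  linarith

/-- The reflection `x ↦ -x` preserves every sector and reverses the sign of the area vector. -/
lemma exists_sectorChart_pos_at {S : OrientedSurface} {p : E3} (hp : p ∈ S.carrier) :
    ∃ c Φ, IsSectorChart S.carrier c Φ ∧ p ∈ Φ.source ∧
      0 < inner ℝ (S.normal p) (areaVec Φ (plproj (Φ p))) := by
  obtain ⟨c, Φ, h, hpΦ⟩ := S.exists_isSectorChart hp
  obtain ⟨hz, hle⟩ := (h.mem_iff p hpΦ).1 hp
  have hu := plproj_mem_dom hpΦ hz
  have hne := inner_normal_areaVec_ne_zero h hu hle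
  rw [param_plproj hpΦ hz] at hne
  rcases lt_or_gt_of_ne hne with hneg | hpos
  · refine ⟨c, Φ.transHomeomorph (affineHomeo (-1) 0 0 0 (by norm_num)),
      ⟨h.diffeo.affine _ _ _ _ _, fun x hx => ?_⟩, hpΦ, ?_⟩
    · rw [h.mem_iff x hx]
      simp [affineHomeo, affineMapE3]
    · set Ψ := Φ.transHomeomorph (affineHomeo (-1) 0 0 0 (by norm_num)) with hΨ
      set L : ℝ × ℝ →L[ℝ] ℝ × ℝ :=
        (-ContinuousLinearMap.fst ℝ ℝ ℝ).prod (ContinuousLinearMap.snd ℝ ℝ ℝ) with hL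
      have hparam : param Ψ = param Φ ∘ L := by
        ext1 u
        change Φ.symm (affineMapE3 _ _ _ _ (incl u)) = Φ.symm _
        congr 1
        apply ext3 <;> simp [affineMapE3, hL]
      have hpt : L (plproj (Ψ p)) = plproj (Φ p) := by
        ext <;> simp [hL, hΨ, affineHomeo, affineMapE3]
      have hd : fderiv ℝ (param Ψ) (plproj (Ψ p)) =
          (fderiv ℝ (param Φ) (plproj (Φ p))).comp L := by
        rw [hparam]
        refine HasFDerivAt.fderiv (HasFDerivAt.comp _ ?_ L.hasFDerivAt)
        rw [hpt]
        exact h.diffeo.hasFDerivAt_param hu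
      have harea : areaVec Ψ (plproj (Ψ p)) = -areaVec Φ (plproj (Φ p)) := by
        have e1 : L (1, 0) = -(1, 0) := by simp [hL]
        have e2 : L (0, 1) = (0, 1) := by simp [hL]
        simp only [areaVec, hd, ContinuousLinearMap.comp_apply, e1, e2, map_neg, ← crossL_apply,
          neg_apply]
      rw [harea, inner_neg_right]
      exact neg_pos.2 hneg
  · exact ⟨c, Φ, h, hpΦ, hpos⟩

/-- Positivity at `p` spreads to a neighbourhood, because the normal and the area vector are
continuous. -/
lemma exists_isPositiveChart {S : OrientedSurface} {p : E3} (hp : p ∈ S.carrier) {O : Set E3}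
    (hO : IsOpen O) (hpO : p ∈ O) :
    ∃ c Φ, IsPositiveChart S c Φ ∧ p ∈ Φ.source ∧ Φ.source ⊆ O := by
  obtain ⟨c, Φ, h, hpΦ, hpos⟩ := exists_sectorChart_pos_at hp
  obtain ⟨hz, hle⟩ := (h.mem_iff p hpΦ).1 hp
  have hu := plproj_mem_dom hpΦ hz
  have cont : ContinuousWithinAt
      (fun x => inner ℝ (S.normal x) (areaVec Φ (plproj (Φ x)))) S.carrier p := by
    refine (S.continuousOn_normal p hp).inner (𝕜 := ℝ) (ContinuousAt.continuousWithinAt ?_)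
    exact ContinuousAt.comp (f := fun x => plproj (Φ x)) (h.diffeo.continuousAt_areaVec hu)
      (plproj.continuous.continuousAt.comp (Φ.continuousAt hpΦ))
  have hev := cont.eventually_mem (isOpen_Ioi.mem_nhds hpos)
  rw [eventually_iff_exists_mem] at hev
  obtain ⟨V, hV, hV2⟩ := hev
  obtain ⟨W, hW, hpW, hW2⟩ := mem_nhdsWithin.1 hV
  refine ⟨c, Φ.restrOpen (W ∩ O) (hW.inter hO), ⟨h.restrOpen _, fun u hu hc => ?_⟩,
    ⟨hpΦ, hpW, hpO⟩, fun x hx => hx.2.2⟩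
  have hu1 : u ∈ dom Φ := hu.1
  have hu2 : param Φ u ∈ W ∩ O := hu.2
  have := hV2 _ (hW2 ⟨hu2.1, (h.param_mem_iff hu1).2 hc⟩)
  rw [plproj_chart_param hu1] at this
  exact this

/-! ### Flux through a chart and its invariance. -/

/-- Extending a function on the domain of a chart by zero. -/
lemma contDiff_indicator_dom {Φ : OpenPartialHomeomorph E3 E3} {K : Set E3} (hK : IsCompact K)
    (hKs : K ⊆ Φ.source) {f : ℝ × ℝ → ℝ} {n : WithTop ℕ∞}
    (hf : ∀ u ∈ dom Φ, ContDiffAt ℝ n f u) (h0 : ∀ u ∈ dom Φ, param Φ u ∉ K → f u = 0) :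
    ContDiff ℝ n ((dom Φ).indicator f) ∧ HasCompactSupport ((dom Φ).indicator f) ∧
      ∀ u ∉ dom Φ, fderiv ℝ ((dom Φ).indicator f) u = 0 := by
  set K' : Set (ℝ × ℝ) := incl ⁻¹' (Φ '' K) with hK'
  have cK' : IsCompact K' :=
    isClosedEmbedding_incl.isCompact_preimage (hK.image_of_continuousOn (Φ.continuousOn.mono hKs))
  have hsub : K' ⊆ dom Φ := by
    rintro u ⟨x, hx, hxu⟩
    change incl u ∈ Φ.target
    rw [← hxu]
    exact Φ.map_source (hKs hx)
  have hz : ∀ u, u ∉ K' → (dom Φ).indicator f u = 0 := by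
    intro u hu
    by_cases hd : u ∈ dom Φ
    · rw [indicator_of_mem hd]
      exact h0 u hd fun hk => hu ⟨_, hk, chart_param hd⟩
    · exact indicator_of_notMem hd f
  -- `K'` is closed and lies in the open set `dom Φ`, so its complement is a neighbourhood of every
  -- point outside `dom Φ`.
  have hev : ∀ u ∉ dom Φ, (dom Φ).indicator f =ᶠ[𝓝 u] fun _ => 0 := fun u hd => by
    filter_upwards [cK'.isClosed.isOpen_compl.mem_nhds fun h => hd (hsub h)] with w hw
      using hz w hw
  refine ⟨contDiff_iff_contDiffAt.2 fun u => ?_, HasCompactSupport.intro cK' hz,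
    fun u hd => by simp [(hev u hd).fderiv_eq]⟩
  by_cases hd : u ∈ dom Φ
  · refine (hf u hd).congr_of_eventuallyEq ?_
    filter_upwards [(isOpen_dom Φ).mem_nhds hd] with w hw using indicator_of_mem hw f
  · exact (contDiffAt_const (c := (0 : ℝ))).congr_of_eventuallyEq (hev u hd)

/-- The flux of a vector field through the part of a surface that lies in a chart. -/
noncomputable def flux (c : ℝ) (Φ : OpenPartialHomeomorph E3 E3) (G : E3 → E3) : ℝ :=
  ∫ u in dom Φ ∩ openSector c, inner ℝ (G (param Φ u)) (areaVec Φ u)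

lemma integrableOn_flux {c : ℝ} {Φ : OpenPartialHomeomorph E3 E3} (hΦ : IsC2Diffeo Φ)
    {G : E3 → E3} (hG : Continuous G) (hc : HasCompactSupport G) (hs : tsupport G ⊆ Φ.source) :
    IntegrableOn (fun u => inner ℝ (G (param Φ u)) (areaVec Φ u)) (dom Φ ∩ openSector c) := by
  obtain ⟨h1, h2, -⟩ := contDiff_indicator_dom (n := 0) (Φ := Φ) hc hs
    (f := fun u => inner ℝ (G (param Φ u)) (areaVec Φ u)) (fun u hu => by
      have hco : ContinuousOn (fun u => inner ℝ (G (param Φ u)) (areaVec Φ u)) (dom Φ) := ?_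
      · exact (contDiffOn_zero.2 hco).contDiffAt ((isOpen_dom Φ).mem_nhds hu)
      intro w hw
      refine ContinuousAt.continuousWithinAt (ContinuousAt.inner ?_ (hΦ.continuousAt_areaVec hw))
      exact hG.continuousAt.comp (hΦ.contDiffAt_param hw).continuousAt)
    (fun u _ hK => by simp [image_eq_zero_of_notMem_tsupport hK])
  have h3 : IntegrableOn _ (dom Φ) :=
    (h1.continuous.integrable_of_hasCompactSupport h2).integrableOn
  refine (h3.congr_fun (fun u hu => indicator_of_mem hu _)
    (isOpen_dom Φ).measurableSet).mono_set inter_subset_left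

/-- The right-hand side does not mention the chart, so coordinate changes map open sectors to open
sectors. -/
lemma IsSectorChart.mem_openSector_iff {M : Set E3} {c : ℝ} {Φ : OpenPartialHomeomorph E3 E3}
    (h : IsSectorChart M c Φ) {x : E3} (hx : x ∈ Φ.source) (hxM : x ∈ M) :
    plproj (Φ x) ∈ openSector c ↔ ¬ IsBoundaryPoint M x := by
  rw [h.isBoundaryPoint_iff hx hxM]
  have := ((h.mem_iff x hx).1 hxM).2
  exact lt_iff_le_and_ne.trans (and_iff_right this)

/-- The domain of a coordinate change between two charts of a surface. -/
def overlap (c : ℝ) (Φ Φ' : OpenPartialHomeomorph E3 E3) : Set (ℝ × ℝ) :=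
  (dom Φ ∩ openSector c) ∩ param Φ ⁻¹' Φ'.source

lemma transition_mem {M : Set E3} {c c' : ℝ} {Φ Φ' : OpenPartialHomeomorph E3 E3}
    (h : IsSectorChart M c Φ) (h' : IsSectorChart M c' Φ') {u : ℝ × ℝ}
    (hu : u ∈ overlap c Φ Φ') :
    plproj (Φ' (param Φ u)) ∈ overlap c' Φ' Φ ∧
      param Φ' (plproj (Φ' (param Φ u))) = param Φ u := by
  obtain ⟨⟨hud, hus⟩, hus'⟩ := hu
  have hs := param_mem_source hud
  have hM : param Φ u ∈ M := (h.param_mem_iff hud).2 (le_of_lt hus)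
  have hz := ((h'.mem_iff _ hus').1 hM).1
  have hp := param_plproj hus' hz
  refine ⟨⟨⟨plproj_mem_dom hus' hz, ?_⟩, ?_⟩, hp⟩
  · rw [h'.mem_openSector_iff hus' hM, ← h.mem_openSector_iff hs hM, plproj_chart_param hud]
    exact hus
  · rw [mem_preimage, hp]
    exact hs

lemma isOpen_overlap {c : ℝ} {Φ Φ' : OpenPartialHomeomorph E3 E3} (hΦ : IsC2Diffeo Φ) :
    IsOpen (overlap c Φ Φ') :=
  (hΦ.continuousOn_param.mono inter_subset_left).isOpen_inter_preimage
    ((isOpen_dom Φ).inter (isOpen_openSector c)) Φ'.open_source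

lemma det_eq_prod (A : ℝ × ℝ →L[ℝ] ℝ × ℝ) :
    A.det = (A (1, 0)).1 * (A (0, 1)).2 - (A (1, 0)).2 * (A (0, 1)).1 := by
  rw [ContinuousLinearMap.det, ← LinearMap.det_toMatrix (Module.Basis.finTwoProd ℝ),
    Matrix.det_fin_two]
  simp [LinearMap.toMatrix_apply]
  ring

/-- The flux through a piece of a surface does not depend on the chart. -/
theorem flux_eq_flux {S : OrientedSurface} {c c' : ℝ} {Φ Φ' : OpenPartialHomeomorph E3 E3}
    (h : IsPositiveChart S c Φ) (h' : IsPositiveChart S c' Φ') {G : E3 → E3}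
    (hG : ∀ x, G x ≠ 0 → x ∈ Φ.source ∧ x ∈ Φ'.source) : flux c Φ G = flux c' Φ' G := by
  -- Where `G` does not vanish both charts are defined, so only the overlap contributes and the
  -- change of variables formula applies.
  have restr {c : ℝ} {Φ Φ' : OpenPartialHomeomorph E3 E3} (h : IsC2Diffeo Φ)
      (hG : ∀ x, G x ≠ 0 → x ∈ Φ'.source) :
      flux c Φ G = ∫ u in overlap c Φ Φ', inner ℝ (G (param Φ u)) (areaVec Φ u) := by
    refine setIntegral_eq_of_subset_of_forall_sdiff_eq_zero
      ((isOpen_dom Φ).inter (isOpen_openSector c)).measurableSet inter_subset_left fun u hu => ?_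
    have : G (param Φ u) = 0 := by
      by_contra hne
      exact hu.2 ⟨hu.1, hG _ hne⟩
    rw [this, inner_zero_left]
  rw [restr (Φ' := Φ') h.diffeo fun x hx => (hG x hx).2,
    restr (Φ' := Φ) h'.diffeo fun x hx => (hG x hx).1]
  set g : ℝ × ℝ → ℝ × ℝ := fun u => plproj (Φ' (param Φ u)) with hg
  have himage : g '' overlap c Φ Φ' = overlap c' Φ' Φ := by
    apply Subset.antisymm
    · rintro _ ⟨u, hu, rfl⟩
      exact (transition_mem h.toIsSectorChart h'.toIsSectorChart hu).1
    · intro v hv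
      obtain ⟨h1, h2⟩ := transition_mem h'.toIsSectorChart h.toIsSectorChart hv
      refine ⟨_, h1, ?_⟩
      simp only [hg, h2]
      exact plproj_chart_param hv.1.1
  have hinj : InjOn g (overlap c Φ Φ') := by
    intro u hu v hv huv
    refine injOn_param Φ hu.1.1 hv.1.1 ?_
    rw [← (transition_mem h.toIsSectorChart h'.toIsSectorChart hu).2,
      ← (transition_mem h.toIsSectorChart h'.toIsSectorChart hv).2]
    exact congrArg (param Φ') huv
  have hd (u : ℝ × ℝ) (hu : u ∈ overlap c Φ Φ') : HasFDerivAt g (fderiv ℝ g u) u := by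
    have : DifferentiableAt ℝ g u := plproj.differentiableAt.comp u
      ((h'.diffeo.hasFDerivAt hu.2).comp u (h.diffeo.hasFDerivAt_param hu.1.1)).differentiableAt
    exact this.hasFDerivAt
  rw [← himage, integral_image_eq_integral_abs_det_fderiv_smul volume
    (isOpen_overlap h.diffeo).measurableSet (fun u hu => (hd u hu).hasFDerivWithinAt) hinj]
  refine setIntegral_congr_fun (isOpen_overlap h.diffeo).measurableSet fun u hu => ?_
  obtain ⟨hgu, hpu⟩ := transition_mem h.toIsSectorChart h'.toIsSectorChart hu
  have hchain (v : ℝ × ℝ) :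
      fderiv ℝ (param Φ) u v = fderiv ℝ (param Φ') (g u) (fderiv ℝ g u v) := by
    have h1 : HasFDerivAt (param Φ' ∘ g) _ u :=
      (h'.diffeo.hasFDerivAt_param hgu.1.1).comp u (hd u hu)
    have h2 : HasFDerivAt (param Φ' ∘ g) (fderiv ℝ (param Φ) u) u := by
      refine (h.diffeo.hasFDerivAt_param hu.1.1).congr_of_eventuallyEq ?_
      filter_upwards [(isOpen_overlap h.diffeo).mem_nhds hu] with w hw
        using (transition_mem h.toIsSectorChart h'.toIsSectorChart hw).2
    exact congrArg (fun A => A v) (h2.unique h1)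
  have harea : areaVec Φ u = (fderiv ℝ g u).det • areaVec Φ' (g u) := by
    have e (v : ℝ × ℝ) : fderiv ℝ (param Φ') (g u) v =
        v.1 • fderiv ℝ (param Φ') (g u) (1, 0) + v.2 • fderiv ℝ (param Φ') (g u) (0, 1) := by
      rw [← map_smul, ← map_smul, ← map_add]
      simp
    rw [areaVec, hchain, hchain, e (fderiv ℝ g u (1, 0)), e (fderiv ℝ g u (0, 1)), cross_lincomb,
      det_eq_prod]
    rfl
  -- Both area vectors have positive inner product with the same normal, so the Jacobian needs no
  -- absolute value.
  have hdet : 0 < (fderiv ℝ g u).det := by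
    have p1 := h.pos u hu.1.1 (le_of_lt hu.1.2)
    have p2 := h'.pos (g u) hgu.1.1 (le_of_lt hgu.1.2)
    rw [hpu] at p2
    rw [harea, inner_smul_right] at p1
    exact (pos_iff_pos_of_mul_pos p1).2 p2
  simp only [smul_eq_mul]
  rw [abs_of_pos hdet, hpu, harea, inner_smul_right]

/-! ### Stokes' theorem in a chart. -/

lemma inner_gradient (ρ : E3 → ℝ) (x v : E3) :
    inner ℝ (gradient ρ x) v = fderiv ℝ ρ x v := by
  rw [← toDual_gradient]
  rfl

/-- The tangent vector to the edge `y = c |x|` of a surface in a chart. -/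
noncomputable def edgeTangent (c : ℝ) (Φ : OpenPartialHomeomorph E3 E3) (x : ℝ) : E3 :=
  fderiv ℝ (param Φ) (x, c * |x|) (1, c * (SignType.sign x : ℝ))

/-- The parameters of the edge in a chart. -/
def edgeDom (c : ℝ) (Φ : OpenPartialHomeomorph E3 E3) : Set ℝ := {x | (x, c * |x|) ∈ dom Φ}

/-- The integral of a vector field along the edge of a surface in a chart. -/
noncomputable def edgeIntegral (c : ℝ) (Φ : OpenPartialHomeomorph E3 E3) (a : E3 → E3) : ℝ :=
  ∫ x in edgeDom c Φ, inner ℝ (a (param Φ (x, c * |x|))) (edgeTangent c Φ x)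

lemma isOpen_edgeDom (c : ℝ) (Φ : OpenPartialHomeomorph E3 E3) : IsOpen (edgeDom c Φ) :=
  (isOpen_dom Φ).preimage (f := fun x : ℝ => (x, c * |x|)) (by fun_prop)

section

variable {c : ℝ} {Φ : OpenPartialHomeomorph E3 E3} {a : E3 → E3}

/-- The component along a coordinate line of the pull-back of a vector field. -/
noncomputable def pullback (Φ : OpenPartialHomeomorph E3 E3) (a : E3 → E3) (v u : ℝ × ℝ) : ℝ :=
  inner ℝ (a (param Φ u)) (fderiv ℝ (param Φ) u v)

lemma contDiffAt_pullback (hΦ : IsC2Diffeo Φ) (ha : ContDiff ℝ 1 a) (v : ℝ × ℝ) {u : ℝ × ℝ}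
    (hu : u ∈ dom Φ) : ContDiffAt ℝ 1 (pullback Φ a v) u :=
  (ha.contDiffAt.comp u ((hΦ.contDiffAt_param hu).of_le one_le_two)).inner ℝ
    ((hΦ.contDiffAt_fderiv_param hu).clm_apply contDiffAt_const)

lemma contDiff_indicator_pullback (hΦ : IsC2Diffeo Φ) (ha : ContDiff ℝ 1 a)
    (hc : HasCompactSupport a) (hs : tsupport a ⊆ Φ.source) (v : ℝ × ℝ) :
    ContDiff ℝ 1 ((dom Φ).indicator (pullback Φ a v)) ∧
      HasCompactSupport ((dom Φ).indicator (pullback Φ a v)) ∧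
      ∀ u ∉ dom Φ, fderiv ℝ ((dom Φ).indicator (pullback Φ a v)) u = 0 :=
  contDiff_indicator_dom hc hs (fun _ hu => contDiffAt_pullback hΦ ha v hu)
    fun u _ hK => by simp [pullback, image_eq_zero_of_notMem_tsupport hK]

lemma fderiv_pullback (hΦ : IsC2Diffeo Φ) (ha : ContDiff ℝ 1 a) (v w : ℝ × ℝ) {u : ℝ × ℝ}
    (hu : u ∈ dom Φ) :
    fderiv ℝ (pullback Φ a v) u w =
      inner ℝ (a (param Φ u)) (fderiv ℝ (fderiv ℝ (param Φ)) u w v) +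
      inner ℝ (fderiv ℝ a (param Φ u) (fderiv ℝ (param Φ) u w)) (fderiv ℝ (param Φ) u v) := by
  have h1 : HasFDerivAt (fun u => a (param Φ u)) _ u :=
    (ha.differentiable one_ne_zero _).hasFDerivAt.comp u (hΦ.hasFDerivAt_param hu)
  have h2 := (((hΦ.contDiffAt_fderiv_param hu).differentiableAt one_ne_zero).hasFDerivAt).clm_apply
    (hasFDerivAt_const v u)
  have h3 := (h1.inner ℝ h2).fderiv
  change fderiv ℝ (pullback Φ a v) u = _ at h3
  rw [h3]
  simp [fderivInnerCLM_apply]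

lemma edgeIntegrand_eq (x : ℝ) (hx : x ∈ edgeDom c Φ) :
    inner ℝ (a (param Φ (x, c * |x|))) (edgeTangent c Φ x) =
      (dom Φ).indicator (pullback Φ a (1, 0)) (x, c * |x|) + c * (SignType.sign x : ℝ) *
        (dom Φ).indicator (pullback Φ a (0, 1)) (x, c * |x|) := by
  have e : ((1 : ℝ), c * (SignType.sign x : ℝ)) =
      (1, 0) + (c * (SignType.sign x : ℝ)) • ((0 : ℝ), (1 : ℝ)) := by simp
  have hx' : (x, c * |x|) ∈ dom Φ := hx
  rw [indicator_of_mem hx', indicator_of_mem hx', edgeTangent, e, map_add, map_smul,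
    inner_add_right, inner_smul_right]
  rfl

lemma integrable_edge {P : ℝ × ℝ → ℝ} (hP : Continuous P) (cP : HasCompactSupport P) (c : ℝ) :
    Integrable fun x => P (x, c * |x|) := by
  have h := hasCompactSupport_snd (cP.comp_homeomorph (shear c)) 0
  refine Continuous.integrable_of_hasCompactSupport (hP.comp (by fun_prop)) ?_
  simpa [shear] using h

lemma integrable_sign_mul_edge {P : ℝ × ℝ → ℝ} (hP : Continuous P) (cP : HasCompactSupport P)
    (c : ℝ) : Integrable fun x => c * (SignType.sign x : ℝ) * P (x, c * |x|) :=
  (integrable_edge hP cP c).bdd_mul (measurable_const_mul_sign c).aestronglyMeasurable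
    (Eventually.of_forall (norm_const_mul_sign_le c))

lemma integrableOn_edge (hΦ : IsC2Diffeo Φ) (ha : ContDiff ℝ 1 a) (hc : HasCompactSupport a)
    (hs : tsupport a ⊆ Φ.source) :
    IntegrableOn (fun x => inner ℝ (a (param Φ (x, c * |x|))) (edgeTangent c Φ x))
      (edgeDom c Φ) := by
  obtain ⟨p1, p2, -⟩ := contDiff_indicator_pullback hΦ ha hc hs (1, 0)
  obtain ⟨q1, q2, -⟩ := contDiff_indicator_pullback hΦ ha hc hs (0, 1)
  refine IntegrableOn.congr_fun ?_ (fun x hx => (edgeIntegrand_eq x hx).symm)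
    (isOpen_edgeDom c Φ).measurableSet
  exact ((integrable_edge p1.continuous p2 c).add
    (integrable_sign_mul_edge q1.continuous q2 c)).integrableOn

/-- Green's theorem in a chart. -/
lemma edgeIntegral_eq (hΦ : IsC2Diffeo Φ) (ha : ContDiff ℝ 1 a) (hc : HasCompactSupport a)
    (hs : tsupport a ⊆ Φ.source) :
    edgeIntegral c Φ a = ∫ u in dom Φ ∩ openSector c,
      (inner ℝ (fderiv ℝ a (param Φ u) (fderiv ℝ (param Φ) u (1, 0)))
        (fderiv ℝ (param Φ) u (0, 1)) -
      inner ℝ (fderiv ℝ a (param Φ u) (fderiv ℝ (param Φ) u (0, 1)))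
        (fderiv ℝ (param Φ) u (1, 0))) := by
  obtain ⟨p1, p2, p3⟩ := contDiff_indicator_pullback hΦ ha hc hs (1, 0)
  obtain ⟨q1, q2, q3⟩ := contDiff_indicator_pullback hΦ ha hc hs (0, 1)
  have hg := green_openSector c p1 q1 p2 q2
  rw [← integral_add (integrable_edge p1.continuous p2 c)
    (integrable_sign_mul_edge q1.continuous q2 c)] at hg
  rw [edgeIntegral, setIntegral_congr_fun (isOpen_edgeDom c Φ).measurableSet
    (fun x hx => edgeIntegrand_eq x hx), setIntegral_eq_integral_of_forall_compl_eq_zero, ← hg]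
  · rw [inter_comm, setIntegral_eq_of_subset_of_forall_sdiff_eq_zero
      (isOpen_openSector c).measurableSet (inter_subset_left (t := dom Φ))]
    · refine setIntegral_congr_fun ((isOpen_openSector c).inter (isOpen_dom Φ)).measurableSet
        fun u hu => ?_
      have e {f : ℝ × ℝ → ℝ} : fderiv ℝ ((dom Φ).indicator f) u = fderiv ℝ f u := by
        refine EventuallyEq.fderiv_eq ?_
        filter_upwards [(isOpen_dom Φ).mem_nhds hu.2] with w hw using indicator_of_mem hw f
      -- The terms with second derivatives of the parametrization cancel by symmetry; this is where
      -- charts must be `C²`.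
      have hsym := ((hΦ.contDiffAt_param hu.2).isSymmSndFDerivAt (by simp)) (1, 0) (0, 1)
      simp only [e]
      rw [fderiv_pullback hΦ ha _ _ hu.2, fderiv_pullback hΦ ha _ _ hu.2, hsym]
      ring
    · intro u hu
      have hd : u ∉ dom Φ := fun h => hu.2 ⟨hu.1, h⟩
      simp [p3 u hd, q3 u hd]
  · intro x hx
    have hd : (x, c * |x|) ∉ dom Φ := hx
    simp [indicator_of_notMem hd]

/-- Stokes' theorem in a chart, for the product of a function with an irrotational field. -/
theorem edgeIntegral_smul_eq_flux (hΦ : IsC2Diffeo Φ) {ρ : E3 → ℝ} (hρ : ContDiff ℝ 1 ρ)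
    (hc : HasCompactSupport ρ) (hs : tsupport ρ ⊆ Φ.source) {F : E3 → E3} (hF : ContDiff ℝ 1 F)
    (hcurl : ∀ x ∈ Φ.source, ∀ v w, inner ℝ (fderiv ℝ F x v) w = inner ℝ (fderiv ℝ F x w) v) :
    edgeIntegral c Φ (fun x => ρ x • F x) =
      flux c Φ (fun x => cross (gradient ρ x) (F x)) := by
  rw [edgeIntegral_eq (a := fun x => ρ x • F x) hΦ (hρ.smul hF) hc.smul_right
    ((tsupport_smul_subset_left ρ F).trans hs)]
  refine setIntegral_congr_fun ((isOpen_dom Φ).inter (isOpen_openSector c)).measurableSet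
    fun u hu => ?_
  have hd (x v : E3) : fderiv ℝ (fun x => ρ x • F x) x v =
      ρ x • fderiv ℝ F x v + (fderiv ℝ ρ x v) • F x := by
    rw [fderiv_fun_smul (hρ.differentiable one_ne_zero x) (hF.differentiable one_ne_zero x)]
    simp
  simp only [hd, areaVec, inner_cross_cross, inner_gradient, inner_add_left, inner_smul_left]
  -- The two terms with a factor `ρ` cancel, leaving those of `∇ρ × F`.
  rw [hcurl _ (param_mem_source hu.1) (fderiv ℝ (param Φ) u (1, 0))]
  simp

end

/-! ### Regularity of loops and line integrals. -/

namespace Loop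

/-- A loop is continuous, and off a finite set it has a bounded derivative. -/
lemma regular (C : Loop) : ContinuousOn C.toFun (Icc 0 C.period) ∧ ∃ (Z : Finset ℝ) (B : ℝ),
    ∀ t ∈ Icc 0 C.period, t ∉ Z → DifferentiableAt ℝ C.toFun t ∧ ‖deriv C.toFun t‖ ≤ B := by
  obtain ⟨N, a, hmono, h0, hN, hC⟩ := C.piecewise_contDiffOn
  have cover : ∀ k : Fin (N + 1), ∀ t ∈ Icc 0 (a k), t = 0 ∨
      ∃ i : Fin N, t ∈ Icc (a i.castSucc) (a i.succ) := by
    intro k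
    induction k using Fin.induction with
    | zero => intro t ht; rw [h0] at ht; exact Or.inl (le_antisymm ht.2 ht.1)
    | succ i ih =>
      intro t ht
      rcases le_total t (a i.castSucc) with h | h
      · exact ih t ⟨ht.1, h⟩
      · exact Or.inr ⟨i, h, ht.2⟩
  have cover' : ∀ t ∈ Icc 0 C.period, ∃ i : Fin N, t ∈ Icc (a i.castSucc) (a i.succ) := by
    intro t ht
    rw [← hN] at ht
    rcases cover _ t ht with rfl | h
    · rcases N with - | N
      · have := C.period_pos
        rw [← hN] at this
        simp only [Fin.last_zero, h0, lt_self_iff_false] at this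
      · refine ⟨0, ?_, ?_⟩
        · simp [h0]
        · rw [← h0]
          exact (hmono (by simp)).le
    · exact h
  have hlt (i : Fin N) : a i.castSucc < a i.succ := hmono Fin.castSucc_lt_succ
  refine ⟨?_, ?_⟩
  · have hU : Icc 0 C.period ⊆ ⋃ i : Fin N, Icc (a i.castSucc) (a i.succ) := fun t ht => by
      simpa using cover' t ht
    refine ContinuousOn.mono ?_ hU
    exact (locallyFinite_of_finite _).continuousOn_iUnion (fun i => isClosed_Icc)
      fun i => (hC i).continuousOn
  · have hb (i : Fin N) : ∃ B, ∀ t ∈ Icc (a i.castSucc) (a i.succ),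
        ‖derivWithin C.toFun (Icc (a i.castSucc) (a i.succ)) t‖ ≤ B :=
      isCompact_Icc.exists_bound_of_continuousOn
        ((hC i).continuousOn_derivWithin (uniqueDiffOn_Icc (hlt i)) le_rfl)
    choose B hB using hb
    -- The exceptional points are those of the subdivision; elsewhere `deriv` agrees with the
    -- one-piece derivative, which is bounded by compactness.
    refine ⟨Finset.univ.image a, ∑ i, |B i|, fun t ht htZ => ?_⟩
    obtain ⟨i, hi⟩ := cover' t ht
    have hne (k : Fin (N + 1)) : a k ≠ t := fun h => htZ (by simp [← h])
    have hnhds : Icc (a i.castSucc) (a i.succ) ∈ 𝓝 t :=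
      Icc_mem_nhds (lt_of_le_of_ne hi.1 (hne _)) (lt_of_le_of_ne hi.2 (hne _).symm)
    refine ⟨((hC i).contDiffAt hnhds).differentiableAt one_ne_zero, ?_⟩
    rw [← derivWithin_of_mem_nhds hnhds]
    exact ((hB i t hi).trans (le_abs_self _)).trans
      (Finset.single_le_sum (f := fun i => |B i|) (fun i _ => abs_nonneg _) (Finset.mem_univ i))

lemma isCompact_image (C : Loop) : IsCompact C.image :=
  isCompact_Icc.image_of_continuousOn C.regular.1

lemma mem_image {C : Loop} {t : ℝ} (ht : t ∈ Icc 0 C.period) : C.toFun t ∈ C.image :=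
  mem_image_of_mem _ ht

lemma IsSimple.injOn_Ioo {C : Loop} (hC : C.IsSimple) : InjOn C.toFun (Ioo 0 C.period) :=
  InjOn.mono Ioo_subset_Ico_self hC

lemma aestronglyMeasurable (C : Loop) :
    AEStronglyMeasurable C.toFun (volume.restrict (Ioc 0 C.period)) :=
  (C.regular.1.mono Ioc_subset_Icc_self).aestronglyMeasurable measurableSet_Ioc

lemma ae_differentiableAt (C : Loop) : ∃ B : ℝ, ∀ᵐ t ∂volume.restrict (Ioc 0 C.period),
    DifferentiableAt ℝ C.toFun t ∧ ‖deriv C.toFun t‖ ≤ B := by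
  obtain ⟨-, Z, B, hZ⟩ := C.regular
  refine ⟨B, (ae_restrict_iff' measurableSet_Ioc).2 ?_⟩
  filter_upwards [compl_mem_ae_iff.2 (Z.countable_toSet.measure_zero volume)] with t ht hI
    using hZ t (Ioc_subset_Icc_self hI) ht

end Loop

/-- The line integral of a vector field along a loop. -/
noncomputable def lineIntegral (a : E3 → E3) (L : Loop) : ℝ :=
  ∫ t in (0 : ℝ)..L.period, inner ℝ (a (L.toFun t)) (deriv L.toFun t)

/-! ### Boundary loops along the edge of a chart. -/

section Edge

variable {S : OrientedSurface} {c : ℝ} {Φ : OpenPartialHomeomorph E3 E3}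

/-- Near a boundary point away from the corner, a loop on the boundary runs along the edge in
the positive direction. -/
lemma deriv_loop_eq (h : IsPositiveChart S c Φ) {L : Loop} (hLS : L.image ⊆ S.boundary)
    (hor : S.InducesOrientationOf L) {t : ℝ} (ht : t ∈ Ioo 0 L.period)
    (hts : L.toFun t ∈ Φ.source) (hd : DifferentiableAt ℝ L.toFun t) (h0 : Φ (L.toFun t) 0 ≠ 0) :
    ∃ x' : ℝ, HasDerivAt (fun t => Φ (L.toFun t) 0) x' t ∧ 0 ≤ x' ∧
      deriv L.toFun t = x' • edgeTangent c Φ (Φ (L.toFun t) 0) := by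
  have edge (s : ℝ) (hs : s ∈ Ioo 0 L.period) (hss : L.toFun s ∈ Φ.source) :
      (Φ (L.toFun s) 0, c * |Φ (L.toFun s) 0|) ∈ dom Φ ∧
      param Φ (Φ (L.toFun s) 0, c * |Φ (L.toFun s) 0|) = L.toFun s := by
    obtain ⟨hS, hb⟩ := hLS (L.mem_image (Ioo_subset_Icc_self hs))
    have hz := ((h.mem_iff _ hss).1 hS).1
    have he : (Φ (L.toFun s) 0, c * |Φ (L.toFun s) 0|) = plproj (Φ (L.toFun s)) :=
      Prod.ext rfl ((h.isBoundaryPoint_iff hss hS).1 hb)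
    rw [he]
    exact ⟨plproj_mem_dom hss hz, param_plproj hss hz⟩
  obtain ⟨hS, -⟩ := hLS (L.mem_image (Ioo_subset_Icc_self ht))
  set x := Φ (L.toFun t) 0 with hx
  set σ : ℝ := (SignType.sign x : ℝ) with hσ
  obtain ⟨hu, hpu⟩ := edge t ht hts
  set u : ℝ × ℝ := (x, c * |x|) with hudef
  set τ := edgeTangent c Φ x with hτ
  have hτ' : τ = fderiv ℝ (param Φ) u (1, c * σ) := rfl
  set n := S.normal (L.toFun t) with hn
  set x' := fderiv ℝ Φ (L.toFun t) (deriv L.toFun t) 0 with hx'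
  have hdΦ := h.diffeo.hasFDerivAt hts
  have d1 : HasDerivAt (fun t => Φ (L.toFun t) 0) x' t :=
    (EuclideanSpace.proj (𝕜 := ℝ) (0 : Fin 3)).hasFDerivAt.comp_hasDerivAt t
      (hdΦ.comp_hasDerivAt t hd.hasDerivAt)
  -- Near `t` the loop is the edge parametrization composed with its own first coordinate, which is
  -- differentiable away from the corner.
  have d2 : deriv L.toFun t = x' • τ := by
    have e1 : HasDerivAt (fun y : ℝ => (y, c * |y|)) (1, c * σ) x :=
      (hasDerivAt_id x).prodMk ((hasDerivAt_abs h0).const_mul c)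
    have e0 : HasFDerivAt (param Φ) (fderiv ℝ (param Φ) u) (x, c * |x|) :=
      h.diffeo.hasFDerivAt_param hu
    have e2 : HasDerivAt (fun y : ℝ => param Φ (y, c * |y|)) τ x :=
      HasFDerivAt.comp_hasDerivAt (f := fun y : ℝ => (y, c * |y|)) x e0 e1
    have e3 : HasDerivAt (fun t => param Φ (Φ (L.toFun t) 0, c * |Φ (L.toFun t) 0|)) (x' • τ) t :=
      HasDerivAt.scomp (h := fun t => Φ (L.toFun t) 0) t e2 d1
    refine (e3.congr_of_eventuallyEq ?_).deriv
    filter_upwards [isOpen_Ioo.mem_nhds ht,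
      hd.continuousAt.eventually_mem (Φ.open_source.mem_nhds hts)] with s hs hss
      using (edge s hs hss).2.symm
  refine ⟨x', d1, ?_, d2⟩
  set v := cross n (deriv L.toFun t) with hv
  have hcone : v ∈ posTangentConeAt S.carrier (L.toFun t) := hor t ht hd
  have dcoord (i : Fin 3) : HasFDerivAt (fun y => Φ y i)
      ((EuclideanSpace.proj (𝕜 := ℝ) i).comp (fderiv ℝ Φ (L.toFun t))) (L.toFun t) :=
    (EuclideanSpace.proj (𝕜 := ℝ) i).hasFDerivAt.comp _ hdΦ
  have hsrc : ∀ᶠ y in 𝓝[S.carrier] (L.toFun t), y ∈ Φ.source ∧ y ∈ S.carrier :=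
    Filter.Eventually.and (nhdsWithin_le_nhds (Φ.open_source.mem_nhds hts)) self_mem_nhdsWithin
  have hmem := (h.mem_iff _ hts).1 hS
  -- The third coordinate is constant on `S`, so its derivative vanishes on the positive tangent
  -- cone, which contains `v = n × L'`.
  have hv2 : fderiv ℝ Φ (L.toFun t) v 2 = 0 := by
    have hconst : ∀ᶠ y in 𝓝[S.carrier] (L.toFun t), Φ y 2 = Φ (L.toFun t) 2 := by
      filter_upwards [hsrc] with y hy
      rw [((h.mem_iff y hy.1).1 hy.2).1, hmem.1]
    have m1 : IsLocalMinOn (fun y => Φ y 2) S.carrier (L.toFun t) := hconst.mono fun y hy => hy.ge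
    have m2 : IsLocalMaxOn (fun y => Φ y 2) S.carrier (L.toFun t) := hconst.mono fun y hy => hy.le
    exact le_antisymm (m2.hasFDerivWithinAt_nonpos (dcoord 2).hasFDerivWithinAt hcone)
      (m1.hasFDerivWithinAt_nonneg (dcoord 2).hasFDerivWithinAt hcone)
  set α := fderiv ℝ Φ (L.toFun t) v 0 with hα
  set β := fderiv ℝ Φ (L.toFun t) v 1 with hβ
  -- On `S` the function `y - c σ x` has a minimum at the edge, so its derivative is nonnegative on
  -- the tangent cone.
  have hlam : 0 ≤ β - c * σ * α := by
    have hmin : IsLocalMinOn (fun y => Φ y 1 - c * σ * Φ y 0) S.carrier (L.toFun t) := by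
      have hc0 : ContinuousAt (fun y => Φ y 0) (L.toFun t) := (dcoord 0).continuousAt
      have habs : ∀ᶠ y in 𝓝 (L.toFun t), |Φ y 0| = σ * Φ y 0 := by
        rcases lt_or_gt_of_ne h0 with hneg | hpos
        · filter_upwards [hc0.eventually_lt_const hneg] with y hy
          rw [abs_of_neg hy, hσ, sign_neg hneg]
          simp
        · filter_upwards [hc0.eventually_const_lt hpos] with y hy
          rw [abs_of_pos hy, hσ, sign_pos hpos]
          simp
      have ht0 : Φ (L.toFun t) 1 = c * (σ * Φ (L.toFun t) 0) := by
        rw [← habs.self_of_nhds, ← (h.isBoundaryPoint_iff hts hS).1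
          (hLS (L.mem_image (Ioo_subset_Icc_self ht))).2]
      filter_upwards [hsrc, nhdsWithin_le_nhds habs] with y hy hya
      have := ((h.mem_iff y hy.1).1 hy.2).2
      rw [hya] at this
      linarith
    have := hmin.hasFDerivWithinAt_nonneg
      ((dcoord 1).sub ((dcoord 0).const_mul (c * σ))).hasFDerivWithinAt hcone
    simpa using this
  set X := fderiv ℝ (param Φ) u (1, 0) with hX
  set Y := fderiv ℝ (param Φ) u (0, 1) with hY
  have lin (w : ℝ × ℝ) : fderiv ℝ (param Φ) u w = w.1 • X + w.2 • Y := by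
    rw [hX, hY, ← map_smul, ← map_smul, ← map_add]
    simp
  have hτXY : τ = (1 : ℝ) • X + (c * σ) • Y := by rw [hτ', lin]
  have hvXY : v = α • X + β • Y := by
    have := h.diffeo.fderiv_param_plproj hu (w := v)
    rw [hpu] at this
    rw [← this hv2, lin]
    rfl
  have hN : 0 < inner ℝ n (areaVec Φ u) := by
    have := h.pos u hu le_rfl
    rwa [hpu] at this
  have hnτ : inner ℝ n τ = 0 := by
    have := inner_normal_fderiv_param h.toIsSectorChart hu le_rfl (1, c * σ)
    rwa [hpu] at this
  have hnorm : ‖n‖ = 1 := S.norm_normal _ hS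
  -- The sign of `x'` comes from computing `n · (τ × v)` twice: in the basis `X`, `Y` it is
  -- nonnegative, and with `v = n × x' τ` it equals `x' ‖τ‖²`.
  have k1 : inner ℝ n (cross τ v) = (β - c * σ * α) * inner ℝ n (areaVec Φ u) := by
    rw [hτXY, hvXY, cross_lincomb, inner_smul_right, one_mul]
    rfl
  have k2 : inner ℝ n (cross τ v) = x' * ‖τ‖ ^ 2 := by
    have e1 : inner ℝ n (cross τ v) = inner ℝ (cross n τ) v := by
      simp only [inner_eq_sum, cross_apply_zero, cross_apply_one, cross_apply_two]
      ring
    rw [e1, hv, inner_cross_cross, d2, inner_smul_right, inner_smul_right, hnτ,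
      real_inner_self_eq_norm_sq, real_inner_self_eq_norm_sq, hnorm]
    ring
  have hτ0 : τ ≠ 0 := by
    intro h0
    have := congrArg (fun w => w 0) (h.diffeo.fderiv_chart_param hu (1, c * σ))
    rw [hτ'] at h0
    simp [h0] at this
  have hτpos : 0 < ‖τ‖ ^ 2 := by positivity
  have : 0 ≤ x' * ‖τ‖ ^ 2 := by
    rw [← k2, k1]
    exact mul_nonneg hlam hN.le
  exact nonneg_of_mul_nonneg_left this hτpos

/-- The part of the edge in a chart that a loop on the boundary covers, up to finitely many
points, and the line integral as an integral over it. -/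
lemma exists_lineIntegral_eq (h : IsPositiveChart S c Φ) {L : Loop} (hLS : L.image ⊆ S.boundary)
    (hsimple : L.IsSimple) (hor : S.InducesOrientationOf L) {a : E3 → E3}
    (ha : ∀ x, a x ≠ 0 → x ∈ Φ.source) :
    ∃ J : Set ℝ, MeasurableSet J ∧ J ⊆ edgeDom c Φ ∧
      (∀ x ∈ J, param Φ (x, c * |x|) ∈ L.image) ∧
      (∃ D : Set ℝ, D.Countable ∧
        ∀ x ∈ edgeDom c Φ, param Φ (x, c * |x|) ∈ L.image → x ∈ J ∨ x ∈ D) ∧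
      lineIntegral a L =
        ∫ x in J, inner ℝ (a (param Φ (x, c * |x|))) (edgeTangent c Φ x) := by
  obtain ⟨hcont, Z, B, hZ⟩ := L.regular
  set x : ℝ → ℝ := fun t => Φ (L.toFun t) 0 with hx
  have edge (s : ℝ) (hs : s ∈ Icc 0 L.period) (hss : L.toFun s ∈ Φ.source) :
      x s ∈ edgeDom c Φ ∧ param Φ (x s, c * |x s|) = L.toFun s := by
    obtain ⟨hS, hb⟩ := hLS (L.mem_image hs)
    have hz := ((h.mem_iff _ hss).1 hS).1
    have he : (x s, c * |x s|) = plproj (Φ (L.toFun s)) :=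
      Prod.ext rfl ((h.isBoundaryPoint_iff hss hS).1 hb)
    rw [edgeDom, mem_ofPred_eq, he]
    exact ⟨plproj_mem_dom hss hz, param_plproj hss hz⟩
  set U : Set ℝ := Ioo 0 L.period ∩ L.toFun ⁻¹' Φ.source with hU
  have oU : IsOpen U :=
    (hcont.mono Ioo_subset_Icc_self).isOpen_inter_preimage isOpen_Ioo Φ.open_source
  have xinj : InjOn x U := by
    intro s hs s' hs' hss
    refine hsimple.injOn_Ioo hs.1 hs'.1 ?_
    rw [← (edge s (Ioo_subset_Icc_self hs.1) hs.2).2,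
      ← (edge s' (Ioo_subset_Icc_self hs'.1) hs'.2).2, hss]
  set V : Set ℝ := {t | t ∈ U ∧ x t = 0} with hV
  -- A simple loop passes the corner at most once.
  have cV : V.Countable :=
    Set.Subsingleton.countable fun s hs s' hs' => xinj hs.1 hs'.1 (hs.2.trans hs'.2.symm)
  set T : Set ℝ := U \ (Z ∪ V) with hT
  have mT : MeasurableSet T :=
    oU.measurableSet.diff (Z.countable_toSet.union cV).measurableSet
  have der (t : ℝ) (ht : t ∈ T) : ∃ x' : ℝ, HasDerivAt x x' t ∧ 0 ≤ x' ∧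
      deriv L.toFun t = x' • edgeTangent c Φ (x t) :=
    deriv_loop_eq h hLS hor ht.1.1 ht.1.2
      (hZ t (Ioo_subset_Icc_self ht.1.1) fun hz => ht.2 (Or.inl hz)).1
      fun h0 => ht.2 (Or.inr ⟨ht.1, h0⟩)
  have derT (t : ℝ) (ht : t ∈ T) : HasDerivWithinAt x (deriv x t) T t := by
    obtain ⟨x', h1, -⟩ := der t ht
    exact h1.differentiableAt.hasDerivAt.hasDerivWithinAt
  have injT : InjOn x T := xinj.mono sdiff_subset
  refine ⟨x '' T, ?_, ?_, ?_, ⟨x '' (Z ∪ V ∪ {0, L.period}), ?_, ?_⟩, ?_⟩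
  · exact measurable_image_of_fderivWithin mT (fun t ht => (derT t ht).hasFDerivWithinAt) injT
  · rintro _ ⟨t, ht, rfl⟩
    exact (edge t (Ioo_subset_Icc_self ht.1.1) ht.1.2).1
  · rintro _ ⟨t, ht, rfl⟩
    rw [(edge t (Ioo_subset_Icc_self ht.1.1) ht.1.2).2]
    exact L.mem_image (Ioo_subset_Icc_self ht.1.1)
  · exact (((Z.countable_toSet.union cV)).union ((countable_singleton _).insert _)).image _
  · rintro y hy ⟨t, ht, hty⟩
    have hs : L.toFun t ∈ Φ.source := by
      rw [hty]
      exact param_mem_source hy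
    have hxy : x t = y := by
      simp only [hx, hty, chart_param (u := (y, c * |y|)) hy, incl_apply_zero]
    by_cases hm : t ∈ (Z : Set ℝ) ∪ V ∪ {0, L.period}
    · exact Or.inr ⟨t, hm, hxy⟩
    · left
      simp only [mem_union, mem_insert_iff, mem_singleton_iff, not_or] at hm
      refine ⟨t, ⟨⟨⟨lt_of_le_of_ne ht.1 (Ne.symm hm.2.1), lt_of_le_of_ne ht.2 hm.2.2⟩, hs⟩, ?_⟩,
        hxy⟩
      rintro (hz | hz)
      exacts [hm.1.1 hz, hm.1.2 hz]
  -- Change of variables by the edge coordinate `x`, injective on `T` by simplicity of the loop;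
  -- `|x'| = x'` because of the orientation.
  · rw [integral_image_eq_integral_abs_deriv_smul mT derT injT, lineIntegral,
      intervalIntegral.integral_of_le L.period_pos.le,
      setIntegral_eq_of_subset_of_ae_sdiff_eq_zero (s := T) measurableSet_Ioc.nullMeasurableSet
        (fun t ht => Ioo_subset_Ioc_self ht.1.1)]
    · refine setIntegral_congr_fun mT fun t ht => ?_
      obtain ⟨x', h1, h2, h3⟩ := der t ht
      simp only [smul_eq_mul]
      rw [h3, (edge t (Ioo_subset_Icc_self ht.1.1) ht.1.2).2, inner_smul_right, h1.deriv,
        abs_of_nonneg h2]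
    · have hcount : ((Z : Set ℝ) ∪ V ∪ {L.period}).Countable :=
        ((Z.countable_toSet.union cV)).union (countable_singleton _)
      filter_upwards [compl_mem_ae_iff.2 (hcount.measure_zero volume)] with t ht hI
      simp only [mem_compl_iff, mem_union, mem_singleton_iff, not_or] at ht
      have : a (L.toFun t) = 0 := by
        by_contra hne
        refine hI.2 ⟨⟨⟨hI.1.1, lt_of_le_of_ne hI.1.2 ht.2⟩, ha _ hne⟩, ?_⟩
        rintro (hz | hz)
        exacts [ht.1.1 hz, ht.1.2 hz]
      rw [this, inner_zero_left]

/-- The integral over the boundary of a field supported in a chart is the integral over the edge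
in the chart. -/
theorem lineIntegral_add_eq_edgeIntegral (h : IsPositiveChart S c Φ) {L L' : Loop}
    (hb : S.HasBoundary L L') {a : E3 → E3} (ha : ContDiff ℝ 1 a) (hc : HasCompactSupport a)
    (hs : tsupport a ⊆ Φ.source) :
    lineIntegral a L + lineIntegral a L' = edgeIntegral c Φ a := by
  obtain ⟨s1, s2, hdisj, hbd, o1, o2⟩ := hb
  have hsupp : ∀ x, a x ≠ 0 → x ∈ Φ.source := fun x hx => hs (subset_tsupport a hx)
  obtain ⟨J, mJ, subJ, imJ, ⟨D, cD, covJ⟩, e⟩ := exists_lineIntegral_eq h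
    (hbd ▸ subset_union_left) s1 o1 hsupp
  obtain ⟨J', mJ', subJ', imJ', ⟨D', cD', covJ'⟩, e'⟩ := exists_lineIntegral_eq h
    (hbd ▸ subset_union_right) s2 o2 hsupp
  have hi := integrableOn_edge (c := c) h.diffeo ha hc hs
  have dJ : Disjoint J J' := by
    rw [Set.disjoint_left]
    intro x hx hx'
    exact Set.disjoint_left.1 hdisj (imJ x hx) (imJ' x hx')
  rw [e, e', ← setIntegral_union dJ mJ' (hi.mono_set subJ) (hi.mono_set subJ'), edgeIntegral]
  symm
  refine setIntegral_eq_of_subset_of_ae_sdiff_eq_zero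
    (isOpen_edgeDom c Φ).measurableSet.nullMeasurableSet (union_subset subJ subJ') ?_
  filter_upwards [compl_mem_ae_iff.2 ((cD.union cD').measure_zero volume)] with x hx hxd
  exfalso
  have hxdom : (x, c * |x|) ∈ dom Φ := hxd.1
  have hS : param Φ (x, c * |x|) ∈ S.carrier := (h.param_mem_iff hxdom).2 le_rfl
  have hB : param Φ (x, c * |x|) ∈ S.boundary := by
    refine ⟨hS, (h.isBoundaryPoint_iff (param_mem_source hxdom) hS).2 ?_⟩
    rw [chart_param hxdom]
    rfl
  rw [hbd] at hB
  rcases hB with hB | hB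
  · rcases covJ x hxd.1 hB with hh | hh
    · exact hxd.2 (Or.inl hh)
    · exact hx (Or.inl hh)
  · rcases covJ' x hxd.1 hB with hh | hh
    · exact hxd.2 (Or.inr hh)
    · exact hx (Or.inr hh)

end Edge

/-! ### Partition of unity and the global Stokes theorem. -/

lemma intervalIntegrable_lineIntegral {a : E3 → E3} (L : Loop)
    (ha : ContinuousOn a L.image) :
    IntervalIntegrable (fun t => inner ℝ (a (L.toFun t)) (deriv L.toFun t)) volume 0 L.period := by
  rw [intervalIntegrable_iff_integrableOn_Ioc_of_le L.period_pos.le]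
  obtain ⟨B, hB⟩ := L.ae_differentiableAt
  obtain ⟨A, hA⟩ := L.isCompact_image.exists_bound_of_continuousOn ha
  have hcomp : ContinuousOn (fun t => a (L.toFun t)) (Icc 0 L.period) :=
    ha.comp L.regular.1 fun t ht => L.mem_image ht
  refine IntegrableOn.of_bound measure_Ioc_lt_top ?_ (A * B) ?_
  · exact ((hcomp.mono Ioc_subset_Icc_self).aestronglyMeasurable measurableSet_Ioc).inner
      (stronglyMeasurable_deriv L.toFun).aestronglyMeasurable
  · filter_upwards [hB, ae_restrict_mem measurableSet_Ioc] with t ht hI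
    have h1 := hA _ (L.mem_image (Ioc_subset_Icc_self hI))
    exact (norm_inner_le_norm _ _).trans
      (mul_le_mul h1 ht.2 (norm_nonneg _) ((norm_nonneg _).trans h1))

lemma continuous_gradient {ρ : E3 → ℝ} (hρ : ContDiff ℝ 1 ρ) : Continuous (gradient ρ) :=
  (InnerProductSpace.toDual ℝ E3).symm.continuous.comp (hρ.continuous_fderiv one_ne_zero)

lemma gradient_eq_zero_of_notMem_tsupport {ρ : E3 → ℝ} {x : E3} (hx : x ∉ tsupport ρ) :
    gradient ρ x = 0 := by
  have h : fderiv ℝ ρ x = 0 := by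
    by_contra hne
    exact hx (support_fderiv_subset ℝ hne)
  simp [gradient, h]

lemma flux_congr {S : OrientedSurface} {c : ℝ} {Φ : OpenPartialHomeomorph E3 E3}
    (h : IsSectorChart S.carrier c Φ) {G G' : E3 → E3} (hG : ∀ x ∈ S.carrier, G x = G' x) :
    flux c Φ G = flux c Φ G' := by
  refine setIntegral_congr_fun ((isOpen_dom Φ).inter (isOpen_openSector c)).measurableSet
    fun u hu => ?_
  rw [hG _ ((h.param_mem_iff hu.1).2 (le_of_lt hu.2))]

lemma flux_sum {c : ℝ} {Φ : OpenPartialHomeomorph E3 E3} (hΦ : IsC2Diffeo Φ)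
    {ι : Type*} (s : Finset ι) {G : ι → E3 → E3} (hG : ∀ i ∈ s, Continuous (G i))
    (hc : ∀ i ∈ s, HasCompactSupport (G i)) (hs : ∀ i ∈ s, tsupport (G i) ⊆ Φ.source) :
    flux c Φ (fun x => ∑ i ∈ s, G i x) = ∑ i ∈ s, flux c Φ (G i) := by
  simp only [flux, sum_inner]
  exact integral_finsetSum s fun i hi => integrableOn_flux hΦ (hG i hi) (hc i hi) (hs i hi)

open scoped Manifold in
/-- A finite atlas of positive charts of a surface, with a partition of unity. -/
lemma exists_charts_partition (S : OrientedSurface) {O : Set E3} (hO : IsOpen O)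
    (hSO : S.carrier ⊆ O) :
    ∃ (ι : Type) (_ : Fintype ι) (c : ι → ℝ) (Φ : ι → OpenPartialHomeomorph E3 E3)
      (ρ : ι → E3 → ℝ), (∀ i, IsPositiveChart S (c i) (Φ i)) ∧ (∀ i, (Φ i).source ⊆ O) ∧
      (∀ i, ContDiff ℝ 1 (ρ i)) ∧ (∀ i, HasCompactSupport (ρ i)) ∧
      (∀ i, tsupport (ρ i) ⊆ (Φ i).source) ∧
      ∀ x ∈ S.carrier, ∀ᶠ y in 𝓝 x, ∑ i, ρ i y = 1 := by
  -- The unit ball bounds the chart domains, which makes the supports in the partition compact.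
  have hch (p : S.carrier) : ∃ c Φ, IsPositiveChart S c Φ ∧ (p : E3) ∈ Φ.source ∧
      Φ.source ⊆ O ∩ Metric.ball (p : E3) 1 :=
    exists_isPositiveChart p.2 (hO.inter Metric.isOpen_ball)
      ⟨hSO p.2, Metric.mem_ball_self one_pos⟩
  choose c Φ hΦ hp hsub using hch
  obtain ⟨t, ht⟩ := S.isCompact_carrier.elim_finite_subcover (fun p => (Φ p).source)
    (fun p => (Φ p).open_source) fun p hpS => mem_iUnion.2 ⟨⟨p, hpS⟩, hp ⟨p, hpS⟩⟩
  have ht' : S.carrier ⊆ ⋃ i : t, (Φ i).source := by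
    intro x hx
    simpa using ht hx
  -- The partition is taken on a compact neighbourhood of `S`, so that its sum is `1` near `S` and
  -- not merely on it; the gradients then sum to zero on `S`.
  obtain ⟨K, hK, hSK, hKO⟩ := exists_compact_between S.isCompact_carrier
    (isOpen_iUnion fun i : t => (Φ i).open_source) ht'
  obtain ⟨f, hf⟩ := SmoothPartitionOfUnity.exists_isSubordinate 𝓘(ℝ, E3) hK.isClosed
    (fun i : t => (Φ i).source) (fun i => (Φ i).open_source) hKO
  set e := Fintype.equivFin t
  refine ⟨Fin (Fintype.card t), inferInstance, fun i => c (e.symm i), fun i => Φ (e.symm i),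
    fun i => f (e.symm i), fun i => hΦ _, fun i => (hsub _).trans inter_subset_left, fun i => ?_,
    fun i => ?_, fun i => hf _, fun x hx => ?_⟩
  · exact (f (e.symm i)).contMDiff.contDiff.of_le (by exact_mod_cast le_top)
  · refine Metric.isCompact_of_isClosed_isBounded (isClosed_tsupport _) ?_
    exact Metric.isBounded_ball.subset ((hf _).trans ((hsub _).trans inter_subset_right))
  · filter_upwards [isOpen_interior.mem_nhds (hSK hx)] with y hy
    have := f.sum_eq_one (interior_subset hy)
    rw [finsum_eq_sum_of_fintype] at this
    rw [← this]
    exact Equiv.sum_comp e.symm fun i => f i y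

lemma lineIntegral_eq_sum {L : Loop} {ι : Type*} [Fintype ι] {ρ : ι → E3 → ℝ} {F : E3 → E3}
    (hF : Continuous F) (hρ : ∀ i, Continuous (ρ i)) (h1 : ∀ x ∈ L.image, ∑ i, ρ i x = 1) :
    lineIntegral F L = ∑ i, lineIntegral (fun x => ρ i x • F x) L := by
  simp only [lineIntegral]
  rw [← intervalIntegral.integral_finsetSum fun i _ =>
    intervalIntegrable_lineIntegral (a := fun x => ρ i x • F x) L ((hρ i).smul hF).continuousOn]
  refine intervalIntegral.integral_congr fun t ht => ?_
  rw [uIcc_of_le L.period_pos.le] at ht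
  simp only [inner_smul_left, ← Finset.sum_mul]
  simp [h1 _ (L.mem_image ht)]

/-- Stokes' theorem: the integral along the boundary of a surface of a vector field that is
irrotational near the surface vanishes. -/
theorem lineIntegral_boundary_eq_zero {S : OrientedSurface} {L L' : Loop}
    (hb : S.HasBoundary L L') {F : E3 → E3} (hF : ContDiff ℝ 1 F) {O : Set E3} (hO : IsOpen O)
    (hSO : S.carrier ⊆ O)
    (hcurl : ∀ x ∈ O, ∀ v w, inner ℝ (fderiv ℝ F x v) w = inner ℝ (fderiv ℝ F x w) v) :
    lineIntegral F L + lineIntegral F L' = 0 := by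
  obtain ⟨ι, _, c, Φ, ρ, hΦ, hsub, hρ, hc, hs, h1⟩ := exists_charts_partition S hO hSO
  have hbd : ∀ x ∈ L.image ∪ L'.image, ∑ i, ρ i x = 1 := fun x hx => by
    rw [← hb.2.2.2.1] at hx
    exact (h1 x hx.1).self_of_nhds
  rw [lineIntegral_eq_sum hF.continuous (fun i => (hρ i).continuous)
      fun x hx => hbd x (Or.inl hx),
    lineIntegral_eq_sum hF.continuous (fun i => (hρ i).continuous)
      fun x hx => hbd x (Or.inr hx), ← Finset.sum_add_distrib]
  set G : ι → E3 → E3 := fun i x => cross (gradient (ρ i) x) (F x) with hG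
  have hGc (i : ι) : Continuous (G i) :=
    (crossL.continuous.comp (continuous_gradient (hρ i))).clm_apply hF.continuous
  have hG0 (i : ι) (x : E3) (hx : x ∉ tsupport (ρ i)) : G i x = 0 := by
    simp only [hG, gradient_eq_zero_of_notMem_tsupport hx, ← crossL_apply, map_zero, zero_apply]
  have hlocal (i : ι) : lineIntegral (fun x => ρ i x • F x) L +
      lineIntegral (fun x => ρ i x • F x) L' = flux (c i) (Φ i) (G i) := by
    rw [lineIntegral_add_eq_edgeIntegral (a := fun x => ρ i x • F x) (hΦ i) hb
      ((hρ i).smul hF) (hc i).smul_right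
      ((tsupport_smul_subset_left _ F).trans (hs i)),
      edgeIntegral_smul_eq_flux (hΦ i).diffeo (hρ i) (hc i) (hs i) hF
        fun x hx => hcurl x (hsub i hx)]
  rw [Finset.sum_congr rfl fun i _ => hlocal i]
  have hcont (i j : ι) : Continuous fun x => ρ j x • G i x := (hρ j).continuous.smul (hGc i)
  have hts (i j : ι) : tsupport (fun x => ρ j x • G i x) ⊆ tsupport (ρ i) := by
    refine closure_minimal (fun x hx => ?_) (isClosed_tsupport _)
    by_contra hne
    exact hx (by simp [hG0 i x hne])
  have hts' (i j : ι) : tsupport (fun x => ρ j x • G i x) ⊆ tsupport (ρ j) :=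
    tsupport_smul_subset_left (ρ j) (G i)
  have hcs (i j : ι) : HasCompactSupport fun x => ρ j x • G i x :=
    (hc j).smul_right
  -- Insert `∑ j, ρ j = 1` and move the `j`-th term, supported in both charts, to chart `j`.
  have step (i : ι) : flux (c i) (Φ i) (G i) =
      ∑ j, flux (c j) (Φ j) (fun x => ρ j x • G i x) := by
    rw [flux_congr (hΦ i).toIsSectorChart (G' := fun x => ∑ j, ρ j x • G i x) fun x hx => by
        rw [← Finset.sum_smul, (h1 x hx).self_of_nhds, one_smul],
      flux_sum (hΦ i).diffeo _ (fun j _ => hcont i j) (fun j _ => hcs i j)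
        fun j _ => (hts i j).trans (hs i)]
    refine Finset.sum_congr rfl fun j _ => flux_eq_flux (hΦ i) (hΦ j) fun x hx => ?_
    have hx' := subset_tsupport (fun x => ρ j x • G i x) hx
    exact ⟨hs i (hts i j hx'), hs j (hts' i j hx')⟩
  rw [Finset.sum_congr rfl fun i _ => step i, Finset.sum_comm]
  refine Finset.sum_eq_zero fun j _ => ?_
  rw [← flux_sum (hΦ j).diffeo _ (fun i _ => hcont i j) (fun i _ => hcs i j)
    fun i _ => (hts' i j).trans (hs j), flux_congr (hΦ j).toIsSectorChart (G' := fun _ => 0)]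
  · simp [flux]
  · intro x hx
    have hgrad : ∑ i, gradient (ρ i) x = 0 := by
      refine ext_inner_right ℝ fun v => ?_
      rw [sum_inner, inner_zero_left]
      simp only [inner_gradient]
      have h2 : fderiv ℝ (fun y => ∑ i, ρ i y) x = ∑ i, fderiv ℝ (ρ i) x :=
        fderiv_fun_sum fun i _ => (hρ i).differentiable one_ne_zero x
      have h3 : fderiv ℝ (fun y => ∑ i, ρ i y) x = 0 := by
        have h4 : (fun y => ∑ i, ρ i y) =ᶠ[𝓝 x] fun _ => 1 := h1 x hx
        rw [h4.fderiv_eq]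
        simp
      rw [h3] at h2
      simpa using (congrArg (fun A => A v) h2).symm
    rw [← Finset.smul_sum, ← cross_sum_left, hgrad, ← crossL_apply]
    simp

/-! ### The Coulomb field. -/

open scoped Pointwise

/-- The Coulomb field `y / ‖y‖ ^ 3`. -/
noncomputable def coulomb (y : E3) : E3 := (‖y‖ ^ 3)⁻¹ • y

lemma inner_cross_coulomb (y m l : E3) :
    inner ℝ (cross (coulomb y) m) l = inner ℝ (cross y m) l / ‖y‖ ^ 3 := by
  simp only [coulomb, inner_eq_sum, cross_apply_zero, cross_apply_one, cross_apply_two,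
    PiLp.smul_apply, smul_eq_mul]
  ring

lemma fderiv_coulomb {y : E3} (hy : y ≠ 0) (v : E3) :
    fderiv ℝ coulomb y v = (‖y‖ ^ 3)⁻¹ • v - (3 * (‖y‖ ^ 5)⁻¹ * inner ℝ y v) • y := by
  have hn : ‖y‖ ≠ 0 := norm_ne_zero_iff.2 hy
  have h1 : HasFDerivAt (fun x : E3 => ‖x‖) (fderiv ℝ (fun x : E3 => ‖x‖) y) y :=
    ((contDiffAt_norm (n := 1) ℝ hy).differentiableAt one_ne_zero).hasFDerivAt
  set N := fderiv ℝ (fun x : E3 => ‖x‖) y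
  -- Obtained by differentiating `‖y‖²` in two ways.
  have hN : ‖y‖ * N v = inner ℝ y v := by
    have h2 := (h1.pow 2).unique (hasStrictFDerivAt_norm_sq y).hasFDerivAt
    have h3 := congrArg (fun A => A v) h2
    simp at h3
    linarith
  have h4 : HasFDerivAt (fun x : E3 => (‖x‖ ^ 3)⁻¹) _ y :=
    (hasDerivAt_inv (pow_ne_zero 3 hn)).comp_hasFDerivAt y (h1.pow 3)
  have h5 : HasFDerivAt coulomb _ y := h4.smul (hasFDerivAt_id y)
  rw [h5.fderiv]
  simp only [add_apply, smul_apply,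
    ContinuousLinearMap.smulRight_apply, ContinuousLinearMap.id_apply, smul_eq_mul,
    sub_eq_add_neg, ← neg_smul]
  congr 2
  rw [← hN]
  field_simp
  simp
  ring

/-- The derivative of the Coulomb field is trace free, which gives the curl of its cross product
with a constant vector. -/
lemma curl_cross_coulomb {y : E3} (hy : y ≠ 0) (m v w : E3) :
    inner ℝ (cross (fderiv ℝ coulomb y v) m) w - inner ℝ (cross (fderiv ℝ coulomb y w) m) v =
      inner ℝ (fderiv ℝ coulomb y m) (cross v w) := by
  have hn : ‖y‖ ≠ 0 := norm_ne_zero_iff.2 hy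
  -- Writing both powers of the norm through `‖y‖⁻⁵` makes the claim a polynomial identity in the
  -- coordinates.
  have h : (‖y‖ ^ 3)⁻¹ = (‖y‖ ^ 5)⁻¹ * (y 0 * y 0 + y 1 * y 1 + y 2 * y 2) := by
    rw [← inner_eq_sum, real_inner_self_eq_norm_sq]
    field_simp
  simp only [fderiv_coulomb hy, h, inner_eq_sum, cross_apply_zero, cross_apply_one,
    cross_apply_two, PiLp.sub_apply, PiLp.smul_apply, smul_eq_mul]
  ring

/-- The Coulomb field can be smoothed near the origin. -/
lemma exists_contDiff_eq_coulomb {ε : ℝ} (hε : 0 < ε) :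
    ∃ E : E3 → E3, ContDiff ℝ 2 E ∧ ∀ y, ε ≤ ‖y‖ → E y = coulomb y := by
  set b : ContDiffBump (0 : E3) := ⟨ε / 2, ε, by positivity, by linarith⟩
  refine ⟨fun y => (1 - b y) • coulomb y, contDiff_iff_contDiffAt.2 fun y => ?_, fun y hy => ?_⟩
  · rcases eq_or_ne y 0 with rfl | hy
    · refine (contDiffAt_const (c := (0 : E3))).congr_of_eventuallyEq ?_
      filter_upwards [b.eventuallyEq_one] with x hx
      simp [hx]
    · have h1 : ContDiffAt ℝ 2 (fun x : E3 => (‖x‖ ^ 3)⁻¹) y :=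
        ((contDiffAt_norm ℝ hy).pow 3).inv (pow_ne_zero 3 (norm_ne_zero_iff.2 hy))
      exact (contDiffAt_const.sub b.contDiffAt).smul (h1.smul contDiffAt_id)
  · have : b y = 0 := b.zero_of_le_dist (by simpa using hy)
    simp [this]

lemma isCompact_sub {K K' : Set E3} (hK : IsCompact K) (hK' : IsCompact K') :
    IsCompact (K - K') := by
  have h := (hK.prod hK').image (f := fun z : E3 × E3 => z.1 - z.2) (by fun_prop)
  rwa [image_prod] at h

/-! ### Differentiating potentials under the integral sign. -/

section Potential

variable {G : Type*} [NormedAddCommGroup G] [NormedSpace ℝ G]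

/-- The field of a current along a loop, for an arbitrary kernel. -/
noncomputable def potential (C : Loop) (K : E3 → E3 →L[ℝ] G) (x : E3) : G :=
  ∫ t in (0 : ℝ)..C.period, K (x - C.toFun t) (deriv C.toFun t)

lemma aestronglyMeasurable_potential (C : Loop) {K : E3 → E3 →L[ℝ] G} (hK : Continuous K)
    (x : E3) : AEStronglyMeasurable (fun t => K (x - C.toFun t) (deriv C.toFun t))
      (volume.restrict (Ioc 0 C.period)) :=
  (ContinuousLinearMap.id ℝ (E3 →L[ℝ] G)).aestronglyMeasurable_comp₂
    (hK.comp_aestronglyMeasurable (aestronglyMeasurable_const.sub C.aestronglyMeasurable))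
    (stronglyMeasurable_deriv C.toFun).aestronglyMeasurable

/-- A dominating constant, uniform for `x` in a ball: the differences `x - C.toFun t` range over a
compact set, and the loop has bounded speed. -/
lemma potential_bound (C : Loop) {K : E3 → E3 →L[ℝ] G} (hK : Continuous K) (x₀ : E3) :
    ∃ M : ℝ, ∀ᵐ t, t ∈ Ioc 0 C.period → ∀ x ∈ Metric.closedBall x₀ 1,
      ‖K (x - C.toFun t)‖ * ‖deriv C.toFun t‖ ≤ M := by
  obtain ⟨M, hM⟩ := (isCompact_sub (isCompact_closedBall x₀ 1) C.isCompact_image)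
    |>.exists_bound_of_continuousOn hK.continuousOn
  obtain ⟨B, hB⟩ := C.ae_differentiableAt
  rw [ae_restrict_iff' measurableSet_Ioc] at hB
  refine ⟨M * B, ?_⟩
  filter_upwards [hB] with t ht hI x hx
  have h1 := hM _ (sub_mem_sub hx (C.mem_image (Ioc_subset_Icc_self hI)))
  exact mul_le_mul h1 (ht hI).2 (norm_nonneg _) ((norm_nonneg _).trans h1)

lemma intervalIntegrable_potential (C : Loop) {K : E3 → E3 →L[ℝ] G} (hK : Continuous K) (x : E3) :
    IntervalIntegrable (fun t => K (x - C.toFun t) (deriv C.toFun t)) volume 0 C.period := by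
  rw [intervalIntegrable_iff_integrableOn_Ioc_of_le C.period_pos.le]
  obtain ⟨M, hM⟩ := potential_bound C hK x
  refine IntegrableOn.of_bound measure_Ioc_lt_top (aestronglyMeasurable_potential C hK x) M ?_
  refine (ae_restrict_iff' measurableSet_Ioc).2 ?_
  filter_upwards [hM] with t ht hI
  exact (ContinuousLinearMap.le_opNorm _ _).trans (ht hI x (Metric.mem_closedBall_self zero_le_one))

lemma continuous_potential (C : Loop) {K : E3 → E3 →L[ℝ] G} (hK : Continuous K) :
    Continuous (potential C K) := by
  refine continuous_iff_continuousAt.2 fun x₀ => ?_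
  obtain ⟨M, hM⟩ := potential_bound C hK x₀
  refine intervalIntegral.continuousAt_of_dominated_interval (bound := fun _ => M) ?_ ?_
    intervalIntegrable_const (Eventually.of_forall fun t _ => ?_)
  · rw [uIoc_of_le C.period_pos.le]
    exact Eventually.of_forall fun x => aestronglyMeasurable_potential C hK x
  · filter_upwards [Metric.closedBall_mem_nhds x₀ one_pos] with x hx
    rw [uIoc_of_le C.period_pos.le]
    filter_upwards [hM] with t ht hI
    exact (ContinuousLinearMap.le_opNorm _ _).trans (ht hI x hx)
  · exact (hK.comp (by fun_prop : Continuous fun x : E3 => x - C.toFun t)).continuousAt.clm_apply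
      continuousAt_const

/-- Only the kernel depends on `x`. Flipping its derivative makes the result again a potential, so
continuity of potentials yields class `C¹`. -/
lemma hasFDerivAt_potential [CompleteSpace G] (C : Loop) {K : E3 → E3 →L[ℝ] G}
    (hK : ContDiff ℝ 1 K) (x : E3) :
    HasFDerivAt (potential C K) (potential C (fun y => (fderiv ℝ K y).flip) x) x := by
  have hK' : Continuous fun y => (fderiv ℝ K y).flip :=
    (ContinuousLinearMap.flipₗᵢ ℝ E3 E3 G).continuous.comp (hK.continuous_fderiv one_ne_zero)
  obtain ⟨M, hM⟩ := potential_bound C hK' x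
  refine intervalIntegral.hasFDerivAt_integral_of_dominated_of_fderiv_le
    (F' := fun x t => (fderiv ℝ K (x - C.toFun t)).flip (deriv C.toFun t))
    (bound := fun _ => M) (Metric.closedBall_mem_nhds x one_pos) ?_
    (intervalIntegrable_potential C hK.continuous x) ?_ ?_ intervalIntegrable_const ?_
  · rw [uIoc_of_le C.period_pos.le]
    exact Eventually.of_forall fun x => aestronglyMeasurable_potential C hK.continuous x
  · rw [uIoc_of_le C.period_pos.le]
    exact aestronglyMeasurable_potential C hK' x
  · rw [uIoc_of_le C.period_pos.le]
    filter_upwards [hM] with t ht hI x hx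
    exact (ContinuousLinearMap.le_opNorm _ _).trans (ht hI x hx)
  · refine Eventually.of_forall fun t _ x _ => ?_
    have h1 : HasFDerivAt (fun x => K (x - C.toFun t)) (fderiv ℝ K (x - C.toFun t)) x := by
      have h0 := (hK.differentiable one_ne_zero (x - C.toFun t)).hasFDerivAt
      exact h0.comp (f := fun x => x - C.toFun t) x ((hasFDerivAt_id x).sub_const (C.toFun t))
    have h2 := h1.clm_apply (hasFDerivAt_const (deriv C.toFun t) x)
    simpa using h2

lemma contDiff_potential [CompleteSpace G] (C : Loop) {K : E3 → E3 →L[ℝ] G}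
    (hK : ContDiff ℝ 1 K) : ContDiff ℝ 1 (potential C K) := by
  refine contDiff_one_iff_fderiv.2 ⟨fun x => (hasFDerivAt_potential C hK x).differentiableAt, ?_⟩
  rw [funext fun x => (hasFDerivAt_potential C hK x).fderiv]
  exact continuous_potential C ((ContinuousLinearMap.flipₗᵢ ℝ E3 E3 G).continuous.comp
    (hK.continuous_fderiv one_ne_zero))

end Potential

/-! ### The Biot–Savart field. -/

/-- The kernel of the Biot–Savart law, for an arbitrary field in place of the Coulomb field. -/
noncomputable def biotSavart (E : E3 → E3) (y : E3) : E3 →L[ℝ] E3 := crossL (E y)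

lemma contDiff_biotSavart {E : E3 → E3} {n : WithTop ℕ∞} (hE : ContDiff ℝ n E) :
    ContDiff ℝ n (biotSavart E) := crossL.contDiff.comp hE

lemma fderiv_biotSavart {E : E3 → E3} (hE : ContDiff ℝ 2 E) (y v w : E3) :
    fderiv ℝ (biotSavart E) y v w = cross (fderiv ℝ E y v) w := by
  have h := crossL.hasFDerivAt.comp y (hE.differentiable two_ne_zero y).hasFDerivAt
  change HasFDerivAt (biotSavart E) _ y at h
  rw [h.fderiv]
  rfl

/-- The Biot–Savart field of a loop is irrotational. -/
lemma fderiv_potential_symm (C : Loop) {E : E3 → E3} (hE : ContDiff ℝ 2 E) {ε : ℝ} (hε : 0 < ε)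
    (hEc : ∀ y, ε ≤ ‖y‖ → E y = coulomb y) {x : E3}
    (hx : ∀ t ∈ Icc 0 C.period, ε < ‖x - C.toFun t‖) (v w : E3) :
    inner ℝ (fderiv ℝ (potential C (biotSavart E)) x v) w =
      inner ℝ (fderiv ℝ (potential C (biotSavart E)) x w) v := by
  have hE1 : ContDiff ℝ 1 E := hE.of_le one_le_two
  have hK := contDiff_biotSavart hE1
  have hK' : Continuous fun y => (fderiv ℝ (biotSavart E) y).flip :=
    (ContinuousLinearMap.flipₗᵢ ℝ E3 E3 E3).continuous.comp (hK.continuous_fderiv one_ne_zero)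
  have hi := intervalIntegrable_potential C hK' x
  have hform (v w : E3) : inner ℝ (fderiv ℝ (potential C (biotSavart E)) x v) w =
      ∫ t in (0 : ℝ)..C.period,
        inner ℝ (cross (fderiv ℝ E (x - C.toFun t) v) (deriv C.toFun t)) w := by
    rw [(hasFDerivAt_potential C hK x).fderiv]
    have h1 := ContinuousLinearMap.intervalIntegral_comp_comm
      ((innerSL ℝ w).comp (ContinuousLinearMap.apply ℝ E3 v)) hi
    rw [real_inner_comm]
    refine h1.symm.trans (intervalIntegral.integral_congr fun t _ => ?_)
    simp [fderiv_biotSavart hE, real_inner_comm w]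
  have hform_int (v w : E3) : IntervalIntegrable (fun t =>
      inner ℝ (cross (fderiv ℝ E (x - C.toFun t) v) (deriv C.toFun t)) w) volume 0 C.period := by
    have h2 := ContinuousLinearMap.integrable_comp
      ((innerSL ℝ w).comp (ContinuousLinearMap.apply ℝ E3 v))
      ((intervalIntegrable_iff_integrableOn_Ioc_of_le C.period_pos.le).1 hi)
    rw [intervalIntegrable_iff_integrableOn_Ioc_of_le C.period_pos.le]
    refine h2.congr (Eventually.of_forall fun t => ?_)
    simp [fderiv_biotSavart hE, real_inner_comm w]
  rw [← sub_eq_zero, hform, hform, ← intervalIntegral.integral_sub (hform_int v w) (hform_int w v)]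
  obtain ⟨hcont, Z, B, hZ⟩ := C.regular
  have hcoul {y : E3} (hy : ε < ‖y‖) : fderiv ℝ E y = fderiv ℝ coulomb y := by
    refine EventuallyEq.fderiv_eq ?_
    filter_upwards [continuous_norm.continuousAt.eventually_const_lt hy] with z hz
      using hEc z hz.le
  have hcurl : ∀ t ∈ Icc 0 C.period,
      inner ℝ (cross (fderiv ℝ E (x - C.toFun t) v) (deriv C.toFun t)) w -
        inner ℝ (cross (fderiv ℝ E (x - C.toFun t) w) (deriv C.toFun t)) v =
      inner ℝ (fderiv ℝ E (x - C.toFun t) (deriv C.toFun t)) (cross v w) := fun t ht => by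
    rw [hcoul (hx t ht)]
    exact curl_cross_coulomb (norm_pos_iff.1 (hε.trans (hx t ht))) _ _ _
  -- The curl integrand is the `t`-derivative of `-E(x - m(t)) · (v × w)`, whose values at the two
  -- ends agree because the loop is closed.
  rw [MeasureTheory.integral_eq_of_hasDerivAt_off_countable_of_le
    (fun t => -inner ℝ (E (x - C.toFun t)) (cross v w)) _ C.period_pos.le Z.countable_toSet]
  · rw [← C.closed, sub_self]
  · refine (ContinuousOn.inner ?_ continuousOn_const).neg
    exact hE.continuous.comp_continuousOn (continuousOn_const.sub hcont)
  · intro t ht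
    have hI := Ioo_subset_Icc_self ht.1
    rw [hcurl t hI]
    have d1 : HasDerivAt (fun t => x - C.toFun t) (-deriv C.toFun t) t :=
      (hZ t hI ht.2).1.hasDerivAt.const_sub x
    have d2 : HasDerivAt (fun t => E (x - C.toFun t)) _ t :=
      HasFDerivAt.comp_hasDerivAt (f := fun t => x - C.toFun t) t
        (hE.differentiable two_ne_zero _).hasFDerivAt d1
    have d3 := d2.inner ℝ (hasDerivAt_const t (cross v w))
    simpa using d3.fun_neg
  · exact (hform_int v w).sub (hform_int w v)

/-! ### The two properties of the Gauss integral. -/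

/-- The Gauss integral is the circulation of the Biot–Savart field. -/
lemma A_eq_lineIntegral (C L : Loop) {E : E3 → E3} (hE : Continuous E) {ε : ℝ}
    (hEc : ∀ y, ε ≤ ‖y‖ → E y = coulomb y)
    (hCL : ∀ x ∈ L.image, ∀ t ∈ Icc 0 C.period, ε ≤ ‖x - C.toFun t‖) :
    A C L = 1 / (4 * Real.pi) * lineIntegral (potential C (biotSavart E)) L := by
  rw [A, lineIntegral]
  congr 1
  refine intervalIntegral.integral_congr fun s hs => ?_
  rw [uIcc_of_le L.period_pos.le] at hs
  have hi := intervalIntegrable_potential C (crossL.continuous.comp hE) (L.toFun s)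
  have h1 := ContinuousLinearMap.intervalIntegral_comp_comm (innerSL ℝ (deriv L.toFun s)) hi
  rw [real_inner_comm]
  refine Eq.trans (intervalIntegral.integral_congr fun t ht => ?_) h1
  rw [uIcc_of_le C.period_pos.le] at ht
  simp only [Function.comp_apply, crossL_apply, innerSL_apply_apply]
  rw [hEc _ (hCL _ (L.mem_image hs) t ht), real_inner_comm _ (deriv L.toFun s),
    inner_cross_coulomb]

lemma exists_pos_le_norm_sub {K K' : Set E3} (hK : IsCompact K) (hK' : IsCompact K')
    (h : Disjoint K K') : ∃ δ > 0, ∀ x ∈ K, ∀ y ∈ K', δ ≤ ‖x - y‖ := by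
  have h0 : (0 : E3) ∈ (K - K')ᶜ := by
    rintro ⟨x, hx, y, hy, hxy⟩
    exact Set.disjoint_left.1 h hx ((sub_eq_zero.1 hxy) ▸ hy)
  obtain ⟨δ, hδ, hsub⟩ := Metric.isOpen_iff.1 (isCompact_sub hK hK').isClosed.isOpen_compl 0 h0
  refine ⟨δ, hδ, fun x hx y hy => ?_⟩
  by_contra hlt
  exact hsub (by simpa using lt_of_not_ge hlt) (sub_mem_sub hx hy)

/-- The Gauss integral is symmetric. -/
theorem A_comm (C L : Loop) (h : Disjoint C.image L.image) : A C L = A L C := by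
  obtain ⟨δ, hδ, hle⟩ := exists_pos_le_norm_sub L.isCompact_image C.isCompact_image h.symm
  obtain ⟨E, hE, hEc⟩ := exists_contDiff_eq_coulomb hδ
  obtain ⟨B, hB⟩ := C.ae_differentiableAt
  obtain ⟨B', hB'⟩ := L.ae_differentiableAt
  obtain ⟨M, hM⟩ := (isCompact_sub L.isCompact_image C.isCompact_image).exists_bound_of_continuousOn
    (crossL.continuous.comp hE.continuous).continuousOn
  set μ := volume.restrict (Ioc 0 L.period)
  set ν := volume.restrict (Ioc 0 C.period)
  -- With the smoothed field the integrand is visibly measurable and bounded; it agrees with the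
  -- Gauss integrand on the parameter rectangle, which justifies Fubini.
  set g : ℝ × ℝ → ℝ := fun z => inner ℝ
    (crossL (E (L.toFun z.1 - C.toFun z.2)) (deriv C.toFun z.2)) (deriv L.toFun z.1) with hg
  have hmem : ∀ᵐ z ∂μ.prod ν, z.1 ∈ Icc 0 L.period ∧ z.2 ∈ Icc 0 C.period := by
    filter_upwards [Measure.quasiMeasurePreserving_fst.ae (ae_restrict_mem measurableSet_Ioc),
      Measure.quasiMeasurePreserving_snd.ae (ae_restrict_mem measurableSet_Ioc)] with z h1 h2
      using ⟨Ioc_subset_Icc_self h1, Ioc_subset_Icc_self h2⟩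
  have hgi : Integrable g (μ.prod ν) := by
    refine Integrable.of_bound ?_ (M * B * B') ?_
    · have m1 : AEStronglyMeasurable (fun z : ℝ × ℝ => crossL (E (L.toFun z.1 - C.toFun z.2)))
          (μ.prod ν) :=
        (crossL.continuous.comp hE.continuous).comp_aestronglyMeasurable
          (L.aestronglyMeasurable.comp_fst.sub C.aestronglyMeasurable.comp_snd)
      exact ((ContinuousLinearMap.id ℝ (E3 →L[ℝ] E3)).aestronglyMeasurable_comp₂ m1
        (stronglyMeasurable_deriv C.toFun).aestronglyMeasurable.comp_snd).inner
        (stronglyMeasurable_deriv L.toFun).aestronglyMeasurable.comp_fst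
    · filter_upwards [hmem, Measure.quasiMeasurePreserving_fst.ae hB',
        Measure.quasiMeasurePreserving_snd.ae hB] with z hz h1 h2
      have h3 := hM _ (sub_mem_sub (L.mem_image hz.1) (C.mem_image hz.2))
      refine (norm_inner_le_norm _ _).trans (mul_le_mul ?_ h1.2 (norm_nonneg _) ?_)
      · exact (ContinuousLinearMap.le_opNorm _ _).trans
          (mul_le_mul h3 h2.2 (norm_nonneg _) ((norm_nonneg _).trans h3))
      · exact mul_nonneg ((norm_nonneg _).trans h3) ((norm_nonneg _).trans h2.2)
  have hfi : Integrable (Function.uncurry fun s t =>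
      inner ℝ (cross (L.toFun s - C.toFun t) (deriv C.toFun t)) (deriv L.toFun s) /
        ‖L.toFun s - C.toFun t‖ ^ 3) (μ.prod ν) := by
    refine hgi.congr ?_
    filter_upwards [hmem] with z hz
    simp only [hg, Function.uncurry]
    rw [hEc _ (hle _ (L.mem_image hz.1) _ (C.mem_image hz.2)), crossL_apply, inner_cross_coulomb]
  simp only [A, intervalIntegral.integral_of_le L.period_pos.le,
    intervalIntegral.integral_of_le C.period_pos.le]
  rw [integral_integral_swap hfi]
  congr 1
  refine integral_congr_ae (Eventually.of_forall fun t => ?_)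
  refine integral_congr_ae (Eventually.of_forall fun s => ?_)
  simp only
  rw [inner_cross_swap, neg_sub, norm_sub_rev]

lemma lineIntegral_reverse (F : E3 → E3) (L : Loop) :
    lineIntegral F L.reverse = -lineIntegral F L := by
  simp only [lineIntegral, Loop.reverse, deriv_comp_const_sub, inner_neg_right]
  rw [intervalIntegral.integral_neg, intervalIntegral.integral_comp_sub_left
    (fun t => inner ℝ (F (L.toFun t)) (deriv L.toFun t))]
  simp

lemma image_reverse (L : Loop) : L.reverse.image = L.image := by
  ext x
  constructor
  · rintro ⟨t, ht, rfl⟩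
    exact ⟨L.period - t, ⟨sub_nonneg.2 ht.2, sub_le_self _ ht.1⟩, rfl⟩
  · rintro ⟨t, ht, rfl⟩
    exact ⟨L.period - t, ⟨sub_nonneg.2 ht.2, sub_le_self _ ht.1⟩, by simp [Loop.reverse]⟩

/-- The Gauss integral does not change along a surface disjoint from one of the loops. -/
theorem A_eq_of_hasBoundary {C L L' : Loop} {S : OrientedSurface}
    (hb : S.HasBoundary L L'.reverse) (hSC : Disjoint S.carrier C.image) : A C L = A C L' := by
  obtain ⟨δ, hδ, hle⟩ := exists_pos_le_norm_sub S.isCompact_carrier C.isCompact_image hSC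
  -- Points within `δ / 3` of `S` are still more than `δ / 3` from `C`, so smoothing at scale `δ /
  -- 3` leaves the field irrotational on a whole neighbourhood of `S`.
  obtain ⟨E, hE, hEc⟩ := exists_contDiff_eq_coulomb (ε := δ / 3) (by positivity)
  have hsub : L.image ∪ L'.reverse.image ⊆ S.carrier := by
    rw [← hb.2.2.2.1]
    exact fun x hx => hx.1
  have hstokes := lineIntegral_boundary_eq_zero hb
    (contDiff_potential C (contDiff_biotSavart (hE.of_le one_le_two)))
    (Metric.isOpen_thickening (δ := δ / 3) (E := S.carrier))
    (Metric.self_subset_thickening (by positivity) _) (fun x hx v w =>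
      fderiv_potential_symm C hE (by positivity) hEc (fun t ht => by
        obtain ⟨p, hp, hxp⟩ := Metric.mem_thickening_iff.1 hx
        have h1 := hle p hp _ (C.mem_image ht)
        have h2 : ‖p - C.toFun t‖ ≤ ‖p - x‖ + ‖x - C.toFun t‖ :=
          norm_sub_le_norm_sub_add_norm_sub ..
        rw [dist_eq_norm, norm_sub_rev] at hxp
        linarith) v w)
  have hfar : ∀ x ∈ S.carrier, ∀ t ∈ Icc 0 C.period, δ / 3 ≤ ‖x - C.toFun t‖ := fun x hx t ht =>
    (by linarith : δ / 3 ≤ δ).trans (hle x hx _ (C.mem_image ht))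
  rw [A_eq_lineIntegral C L hE.continuous hEc fun x hx => hfar x (hsub (Or.inl hx)),
    A_eq_lineIntegral C L' hE.continuous hEc fun x hx =>
      hfar x (hsub (Or.inr (by rwa [image_reverse])))]
  rw [lineIntegral_reverse] at hstokes
  rw [add_neg_eq_zero.1 hstokes]

end GaussIntegral

theorem proposition5p2 :
    (∀ C L : GaussIntegral.Loop, Disjoint C.image L.image →
      GaussIntegral.A C L = GaussIntegral.A L C) ∧
    (∀ (C L L' : GaussIntegral.Loop) (S : GaussIntegral.OrientedSurface),
      S.HasBoundary L L'.reverse → Disjoint S.carrier C.image →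
      GaussIntegral.A C L = GaussIntegral.A C L') :=
  ⟨GaussIntegral.A_comm, fun _ _ _ _ => GaussIntegral.A_eq_of_hasBoundary⟩
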